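/- **Theorem 3.2.** All graphs are finite and simple. A non-increasing sequence $\pi=(d_1,\dots,d_n)$ of nonnegative integers is *graphic* if it is the degree sequence of some graph of order $n$ (a *realization* of $\pi$), and *potentially $H$-graphic* if some realization of $\pi$ contains $H$ as a subgraph. In a sequence, $r^t$ stands for $t$ consecutive terms equal to $r$. Let $A_3=P_2\cup K_2$ be the disjoint union of the path $P_2$ on three vertices (two edges) and a single edge, and let $K_5-A_3$ be the graph obtained from $K_5$ by removing the three edges of a copy of $A_3$. Let $\pi=(d_1,d_2,\dots,d_n)$ be a graphic sequence with $n\ge 5$ and without zero terms, i.e. $d_1\ge d_2\ge\cdots\ge d_n\ge 1$. Then $\pi$ is potentially $K_5-A_3$-graphic if and only if the following three conditions hold. 1. $d_4\ge 3$ and $d_5\ge 2$. 2. If $n\ge 6$, then $\pi\ne(n-1,3^3,2^{n-k},1^{k-4})$ for every integer $k$ with $4\le k\le n-2$ and $k\equiv n\pmod 2$. 3. $\pi$ is none of the sequences $(3^4,2^2)$, $(3^6)$, $(3^4,2^3)$, $(3^6,2)$, $(4,3^6)$, $(3^7,1)$, $(3^8)$, $(n-1,3^5,1^{n-6})$ (for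 $n\ge 6$), $(n-1,3^6,1^{n-7})$ (for $n\ge 7$). -/

import Mathlib

/-- The non-increasing sequence `π = (π 0, …, π (n-1))` is the degree sequence of the simple graph
`G` of order `n`, the vertices being numbered so that the `i`-th vertex has degree `π i`. -/
def IsRealization {n : ℕ} (G : SimpleGraph (Fin n)) (π : Fin n → ℕ) : Prop :=
  ∀ i, (G.neighborSet i).ncard = π i

/-- A graphic sequence: a non-increasing sequence of nonnegative integers that is the degree
sequence of some simple graph. -/
def IsGraphic {n : ℕ} (π : Fin n → ℕ) : Prop :=
  Antitone π ∧ ∃ G : SimpleGraph (Fin n), IsRealization G π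

/-- `π` is potentially `H`-graphic: some realization of `π` contains `H` as a (not necessarily
induced) subgraph. -/
def IsPotentiallyGraphic {V : Type*} (H : SimpleGraph V) {n : ℕ} (π : Fin n → ℕ) : Prop :=
  Antitone π ∧ ∃ G : SimpleGraph (Fin n), IsRealization G π ∧ H.IsContained G

/-- `A₃ = P₂ ∪ K₂`, the disjoint union of the path on three vertices (two edges) and an edge;
it has five vertices. -/
def graphA3 : SimpleGraph (Fin 3 ⊕ Fin 2) :=
  SimpleGraph.pathGraph 3 ⊕g (⊤ : SimpleGraph (Fin 2))

/-- `K₅ - A₃`: the complete graph on five vertices with the three edges of `A₃` removed. -/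
def graphK5SubA3 : SimpleGraph (Fin 3 ⊕ Fin 2) :=
  (⊤ : SimpleGraph (Fin 3 ⊕ Fin 2)).deleteEdges graphA3.edgeSet

/-- The terms `r, r, …, r` (`t` times), written `r^t` in a degree sequence. -/
abbrev rep (r t : ℕ) : List ℕ := List.replicate t r

/-! Everything is phrased for degree multisets, since any realization can be transported to any
vertex type carrying the same degrees. `Graphic` is `Pot` with an empty pattern, so one set of
lemmas serves both notions.

Sufficiency is an induction on the number of terms. A smallest term `k` is laid off: `k` largest
other terms drop by one, and the result is still graphic by the Kleitman–Wang exchange argument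
(`exists_neighborSet_eq`, `Graphic.layOff`). If the shorter sequence has a realization containing
`K₅ - A₃`, joining a new vertex to the lowered ones gives one for the original (`Pot.addVertex`).
The induction breaks only where the residual is exceptional. Then the original is itself
exceptional, or is one of finitely many small sequences realized by hand, or lies in a family
obtained by hanging triangles on one vertex. Terms at most three are recorded only by their
multiplicities in `low`. `pot_cons_low` treats sequences with at most one term above three, where
all exceptions live; `pot_add_low` shows that two or more such terms never give an exception.

Necessity uses two obstructions. The seven sporadic sequences fail an edge count across a copy of
`K₅ - A₃` (`exists_five_of_isContained`), a finite check. In the infinite families a dominating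
vertex must belong to the copy; deleting it leaves a four-cycle whose vertices have no further
edges, which restricts the number of threes (`card_degree_three_of_isContained`). -/

/-! ### Degree multisets and adding a vertex -/

/-- The finite graph degrees listed by `s` are realized by a graph containing `K`. -/
def Pot {U : Type} (K : SimpleGraph U) (s : Multiset ℕ) : Prop :=
  ∃ (V : Type) (_ : Fintype V) (f : V → ℕ) (G : SimpleGraph V),
    Finset.univ.val.map f = s ∧ (∀ v, (G.neighborSet v).ncard = f v) ∧ K.IsContained G

/-- `s` is the degree multiset of a finite simple graph. -/
abbrev Graphic (s : Multiset ℕ) : Prop := Pot (⊥ : SimpleGraph Empty) s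

/-- Equal value multisets mean equinumerous fibres; bijections between the fibres glue together. -/
theorem exists_equiv_of_map_univ_eq {V W : Type} [Fintype V] [Fintype W] {f : V → ℕ} {g : W → ℕ}
    (h : Finset.univ.val.map f = Finset.univ.val.map g) : ∃ e : V ≃ W, ∀ v, g (e v) = f v := by
  classical
  have key : ∀ k, Nonempty ({v // f v = k} ≃ {w // g w = k}) := by
    intro k
    refine ⟨Fintype.equivOfCardEq ?_⟩
    have := congrArg (Multiset.count k) h
    rw [Multiset.count_map, Multiset.count_map] at this
    rw [Fintype.card_subtype, Fintype.card_subtype]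
    simpa [Finset.card_def, eq_comm] using this
  let e := fun k => (key k).some
  refine ⟨(Equiv.sigmaFiberEquiv f).symm.trans
    ((Equiv.sigmaCongrRight e).trans (Equiv.sigmaFiberEquiv g)), fun v => ?_⟩
  simp only [Equiv.trans_apply]
  exact (e (f v) ⟨v, rfl⟩).2

/-- A degree function with the right multiset of values is realized on its own index type. -/
theorem Pot.realize {U : Type} {K : SimpleGraph U} {s : Multiset ℕ} (h : Pot K s)
    {W : Type} [Fintype W] (g : W → ℕ) (hg : Finset.univ.val.map g = s) :
    ∃ G : SimpleGraph W, (∀ v, (G.neighborSet v).ncard = g v) ∧ K.IsContained G := by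
  obtain ⟨V, _, f, G, hf, hd, hK⟩ := h
  obtain ⟨e, he⟩ := exists_equiv_of_map_univ_eq (hg.trans hf.symm)
  refine ⟨G.comap e, fun v => ?_, ?_⟩
  · rw [← he v, ← hd (e v), ← Set.ncard_image_of_injective _ e.injective]
    congr 1
    ext w
    simp only [Set.mem_image, SimpleGraph.mem_neighborSet, SimpleGraph.comap_adj]
    exact ⟨by rintro ⟨x, hx, rfl⟩; exact hx, fun hw => ⟨e.symm w, by simpa using hw, by simp⟩⟩
  · exact hK.trans ⟨(SimpleGraph.Iso.comap e G).symm.toCopy⟩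

theorem Multiset.exists_fin_map_eq (t : Multiset ℕ) :
    ∃ (k : ℕ) (f : Fin k → ℕ), Finset.univ.val.map f = t := by
  induction t using Quotient.inductionOn with
  | h l => exact ⟨l.length, l.get, by simp⟩

theorem Multiset.map_univ_option {α : Type} [Fintype α] (F : Option α → ℕ) :
    Finset.univ.val.map F = F none ::ₘ Finset.univ.val.map (fun a => F (some a)) := by
  have : (Finset.univ : Finset (Option α)) =
      Finset.cons none (Finset.univ.map Function.Embedding.some) (by simp) := by
    ext (_ | a) <;> simp
  rw [this, Finset.cons_val, Multiset.map_cons, Finset.map_val, Multiset.map_map]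
  rfl

/-- A concrete vertex set for adding or removing a vertex: `none` is that vertex, the left summand
its neighbours, the right summand everything else. -/
theorem Multiset.exists_option_sum_map_eq (d : ℕ) (t u : Multiset ℕ) :
    ∃ (p q : ℕ) (f : Fin p → ℕ) (g : Fin q → ℕ), Finset.univ.val.map f = t ∧
      Finset.univ.val.map g = u ∧
      (Finset.univ : Finset (Fin p ⊕ Fin q)).val.map (Sum.elim f g) = t + u ∧
      (Finset.univ : Finset (Option (Fin p ⊕ Fin q))).val.map
        (fun o => o.elim d (Sum.elim f g)) = d ::ₘ (t + u) := by
  obtain ⟨p, f, hf⟩ := Multiset.exists_fin_map_eq t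
  obtain ⟨q, g, hg⟩ := Multiset.exists_fin_map_eq u
  have h3 : (Finset.univ : Finset (Fin p ⊕ Fin q)).val.map (Sum.elim f g) = t + u := by
    rw [← Finset.univ_disjSum_univ, Finset.val_disjSum, Multiset.disjSum, Multiset.map_add,
      Multiset.map_map, Multiset.map_map, ← hf, ← hg]
    rfl
  refine ⟨p, q, f, g, hf, hg, h3, ?_⟩
  rw [← h3, Multiset.map_univ_option]
  rfl

/-- Adding a new vertex joined to the vertices whose degrees form `t`. -/
theorem Pot.addVertex {U : Type} {K : SimpleGraph U} {t u : Multiset ℕ} (h : Pot K (t + u)) :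
    Pot K (Multiset.card t ::ₘ (t.map (· + 1) + u)) := by
  classical
  obtain ⟨p, q, f, g, hf, hg, h1, -⟩ := Multiset.exists_option_sum_map_eq 0 t u
  obtain ⟨G, hG, hK⟩ := h.realize _ h1
  let G' : SimpleGraph (Option (Fin p ⊕ Fin q)) :=
    { Adj := fun x y => match x, y with
        | none, none => False
        | none, some y => y.isLeft
        | some x, none => x.isLeft
        | some x, some y => G.Adj x y
      symm := ⟨by rintro (_ | x) (_ | y) hxy <;> first | exact hxy | exact SimpleGraph.Adj.symm hxy⟩
      loopless := ⟨by rintro (_ | x) hx <;> first | exact hx | exact G.irrefl hx⟩ }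
  have hs : ∀ x, G'.neighborSet (some x) =
      some '' (G.neighborSet x) ∪ (if x.isLeft then {none} else ∅) := by
    intro x
    ext (_ | y)
    · cases x <;> simp [G']
    · cases x <;> simp [G']
  refine ⟨Option (Fin p ⊕ Fin q), inferInstance,
    fun o => o.elim p (Sum.elim (fun i => f i + 1) g), G', ?_, ?_, ?_⟩
  · rw [Multiset.map_univ_option]
    have hp : Multiset.card t = p := by simp [← hf]
    have : (Finset.univ : Finset (Fin p ⊕ Fin q)).val.map (Sum.elim (fun i => f i + 1) g)
        = t.map (· + 1) + u := by
      rw [← Finset.univ_disjSum_univ, Finset.val_disjSum, Multiset.disjSum, Multiset.map_add,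
        Multiset.map_map, Multiset.map_map, ← hf, ← hg, Multiset.map_map]
      rfl
    rw [← this, hp]
    rfl
  · rintro (_ | x)
    · have : G'.neighborSet none = some '' (Set.range Sum.inl) := by
        ext (_ | y)
        · simp [G']
        · cases y <;> simp [G']
      rw [this, Set.ncard_image_of_injective _ (Option.some_injective _),
        ← Set.image_univ, Set.ncard_image_of_injective _ Sum.inl_injective]
      simp
    · rw [hs]
      cases x with
      | inl i =>
        rw [if_pos (by rfl), Set.ncard_union_eq (by simp) (Set.toFinite _) (Set.toFinite _),
          Set.ncard_image_of_injective _ (Option.some_injective _), hG]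
        simp
      | inr j =>
        rw [if_neg (by simp), Set.union_empty,
          Set.ncard_image_of_injective _ (Option.some_injective _), hG]
        simp
  · exact hK.trans ⟨⟨⟨some, fun h => h⟩, Option.some_injective _⟩⟩

/-- The splitting is given through equations, so that concrete cases close by `decide` and
parametric ones by `abel`. -/
theorem Pot.addVertex_of_eq {U : Type} {K : SimpleGraph U} {s s' : Multiset ℕ} (h : Pot K s)
    (t u : Multiset ℕ) (h1 : s = t + u) (h2 : s' = Multiset.card t ::ₘ (t.map (· + 1) + u)) :
    Pot K s' := by
  subst h1 h2
  exact h.addVertex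

/-! ### Edge switching and laying off a term -/

section Switch

variable {V : Type} [DecidableEq V]

/-- The permutation applied to the neighbourhood of `x` when `vb, aw` are switched to `va, bw`. -/
def switchPerm (v w a b x : V) : Equiv.Perm V :=
  if x = v ∨ x = w then Equiv.swap a b else if x = a ∨ x = b then Equiv.swap v w else 1

/-- The graph with the edges `vb, aw` replaced by `va, bw`. -/
def switchGraph (G : SimpleGraph V) (v w a b : V) (hva : v ≠ a) (hvb : v ≠ b) (hwa : w ≠ a)
    (hwb : w ≠ b) (h1 : G.Adj v b) (h2 : G.Adj a w) (h3 : ¬ G.Adj v a) (h4 : ¬ G.Adj b w) :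
    SimpleGraph V where
  -- Each neighbourhood is moved by a permutation, so degrees are preserved automatically; the price
  -- is that symmetry needs a case check.
  Adj x y := G.Adj x (switchPerm v w a b x y)
  symm := ⟨by
    have h1' := h1.symm
    have h2' := h2.symm
    have h3' : ¬ G.Adj a v := fun h => h3 h.symm
    have h4' : ¬ G.Adj w b := fun h => h4 h.symm
    intro x y hxy
    rw [G.adj_comm]
    unfold switchPerm at *
    by_cases hx : x = v ∨ x = w
    · rw [if_pos hx] at hxy
      by_cases hy : y = v ∨ y = w
      · rw [if_pos hy]
        rw [Equiv.swap_apply_of_ne_of_ne (by grind) (by grind)] at hxy ⊢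
        exact hxy
      · rw [if_neg hy]
        by_cases hy' : y = a ∨ y = b
        · rw [if_pos hy']
          rcases hx with rfl | rfl <;> rcases hy' with rfl | rfl <;> simp_all
        · rw [if_neg hy']
          rw [Equiv.swap_apply_of_ne_of_ne (by grind) (by grind)] at hxy
          exact hxy
    · rw [if_neg hx] at hxy
      by_cases hx' : x = a ∨ x = b
      · rw [if_pos hx'] at hxy
        by_cases hy : y = v ∨ y = w
        · rw [if_pos hy]
          rcases hx' with rfl | rfl <;> rcases hy with rfl | rfl <;> simp_all
        · rw [if_neg hy]
          rw [Equiv.swap_apply_of_ne_of_ne (by grind) (by grind)] at hxy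
          by_cases hy' : y = a ∨ y = b
          · rw [if_pos hy', Equiv.swap_apply_of_ne_of_ne (by grind) (by grind)]
            exact hxy
          · rw [if_neg hy']
            exact hxy
      · rw [if_neg hx'] at hxy
        by_cases hy : y = v ∨ y = w
        · rw [if_pos hy, Equiv.swap_apply_of_ne_of_ne (by grind) (by grind)]
          exact hxy
        · rw [if_neg hy]
          by_cases hy' : y = a ∨ y = b
          · rw [if_pos hy', Equiv.swap_apply_of_ne_of_ne (by grind) (by grind)]
            exact hxy
          · rw [if_neg hy']
            exact hxy⟩
  loopless := ⟨by
    intro x hx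
    unfold switchPerm at hx
    split_ifs at hx with h h'
    · rw [Equiv.swap_apply_of_ne_of_ne (by grind) (by grind)] at hx
      exact G.irrefl hx
    · rw [Equiv.swap_apply_of_ne_of_ne (by grind) (by grind)] at hx
      exact G.irrefl hx
    · exact G.irrefl hx⟩

theorem exists_switch [Finite V] (G : SimpleGraph V) {v w a b : V} (hva : v ≠ a) (hvb : v ≠ b)
    (hwa : w ≠ a) (hwb : w ≠ b) (h1 : G.Adj v b) (h2 : G.Adj a w) (h3 : ¬ G.Adj v a)
    (h4 : ¬ G.Adj b w) :
    ∃ G' : SimpleGraph V, (∀ x, (G'.neighborSet x).ncard = (G.neighborSet x).ncard) ∧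
      ∀ y, G'.Adj v y ↔ G.Adj v (Equiv.swap a b y) := by
  refine ⟨switchGraph G v w a b hva hvb hwa hwb h1 h2 h3 h4, fun x => ?_, fun y => ?_⟩
  · rw [← Set.ncard_image_of_injective _ (switchPerm v w a b x).injective]
    congr 1
    ext y
    constructor
    · rintro ⟨z, hz, rfl⟩
      exact hz
    · intro hy
      refine ⟨(switchPerm v w a b x).symm y, ?_, by simp⟩
      change G.Adj x (switchPerm v w a b x _)
      simpa using hy
  · change G.Adj v (switchPerm v w a b v y) ↔ _
    simp [switchPerm]

end Switch

/-- Kleitman–Wang: a vertex can be made adjacent to a set of vertices of largest degrees. -/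
theorem exists_neighborSet_eq {V : Type} [Fintype V] (G : SimpleGraph V) (v : V) (T : Set V)
    (hvT : v ∉ T) (hcard : (G.neighborSet v).ncard = T.ncard)
    (hT : ∀ a ∈ T, ∀ b ∉ T, b ≠ v → (G.neighborSet b).ncard ≤ (G.neighborSet a).ncard) :
    ∃ G' : SimpleGraph V, (∀ x, (G'.neighborSet x).ncard = (G.neighborSet x).ncard) ∧
      G'.neighborSet v = T := by
  classical
  -- Each switch brings one more vertex of `T` into the neighbourhood of `v`.
  induction hm : (T \ G.neighborSet v).ncard using Nat.strong_induction_on generalizing G with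
  | _ m ih =>
    by_cases hsub : T ⊆ G.neighborSet v
    · exact ⟨G, fun _ => rfl, (Set.eq_of_subset_of_ncard_le hsub hcard.le (Set.toFinite _)).symm⟩
    obtain ⟨a, haT, haN⟩ := Set.not_subset.1 hsub
    have hsub' : ¬ G.neighborSet v ⊆ T := fun h =>
      hsub (Set.eq_of_subset_of_ncard_le h hcard.ge (Set.toFinite _)).ge
    obtain ⟨b, hbN, hbT⟩ := Set.not_subset.1 hsub'
    have hvb : G.Adj v b := hbN
    have hva : ¬ G.Adj v a := haN
    have hne : v ≠ a := fun h => hvT (h ▸ haT)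
    have hab : a ≠ b := fun h => hbT (h ▸ haT)
    -- `a` has degree at least that of `b`, but `v` is adjacent to `b` and not to `a`. So `a` must
    -- have a neighbour that `b` lacks; otherwise, setting aside a possible edge `ab`, the
    -- neighbourhood of `a` would be strictly smaller.
    obtain ⟨w, haw, hbw, hwb⟩ : ∃ w, G.Adj a w ∧ ¬ G.Adj b w ∧ w ≠ b := by
      by_contra hcon
      push Not at hcon
      have hle := hT a haT b hbT hvb.ne'
      have hss : G.neighborSet a \ {b} ⊂ G.neighborSet b \ {a} := by
        refine ⟨fun w hw => ?_, fun h => ?_⟩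
        · have h1 : G.Adj a w := hw.1
          refine ⟨?_, h1.ne'⟩
          by_contra h2
          exact hw.2 (hcon w h1 h2)
        · have : v ∈ G.neighborSet a \ {b} := h ⟨hvb.symm, hne⟩
          exact hva this.1.symm
      have hlt := Set.ncard_lt_ncard hss (Set.toFinite _)
      by_cases hadj : G.Adj a b
      · rw [Set.ncard_sdiff_singleton_of_mem (show b ∈ G.neighborSet a from hadj),
          Set.ncard_sdiff_singleton_of_mem (show a ∈ G.neighborSet b from hadj.symm)] at hlt
        omega
      · rw [Set.sdiff_singleton_eq_self (show b ∉ G.neighborSet a from hadj),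
          Set.sdiff_singleton_eq_self (show a ∉ G.neighborSet b from fun h => hadj h.symm)] at hlt
        omega
    obtain ⟨G', hdeg, hadj⟩ := exists_switch G hne hvb.ne haw.ne' hwb hvb haw hva hbw
    have := ih _ ?_ G' (by rw [hdeg, hcard]) (by simpa only [hdeg] using hT) rfl
    · obtain ⟨G'', h1, h2⟩ := this
      exact ⟨G'', fun x => (h1 x).trans (hdeg x), h2⟩
    · rw [← hm]
      refine Set.ncard_lt_ncard ⟨fun x hx => ?_, fun h => ?_⟩ (Set.toFinite _)
      · refine ⟨hx.1, fun hxN => hx.2 ?_⟩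
        change G'.Adj v x
        rw [hadj]
        rwa [Equiv.swap_apply_of_ne_of_ne]
        · rintro rfl; exact hva hxN
        · rintro rfl; exact hbT hx.1
      · have := (h ⟨haT, haN⟩).2
        apply this
        change G'.Adj v a
        rw [hadj]
        simpa using hvb

/-- Laying off a term of a graphic sequence from terms at least as large as the others. -/
theorem Graphic.layOff {t u : Multiset ℕ} (h : Graphic (Multiset.card t ::ₘ (t + u)))
    (htu : ∀ a ∈ t, ∀ b ∈ u, b ≤ a) : Graphic (t.map (· - 1) + u) := by
  classical
  obtain ⟨p, q, f, g, hf, hg, -, h1⟩ := Multiset.exists_option_sum_map_eq (Multiset.card t) t u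
  obtain ⟨G, hG, -⟩ := h.realize _ h1
  have hp : Multiset.card t = p := by simp [← hf]
  let T : Set (Option (Fin p ⊕ Fin q)) := some '' Set.range Sum.inl
  have hTc : T.ncard = p := by
    rw [Set.ncard_image_of_injective _ (Option.some_injective _),
      ← Set.image_univ, Set.ncard_image_of_injective _ Sum.inl_injective]
    simp
  obtain ⟨G', hG', hN⟩ := exists_neighborSet_eq G none T (by simp [T])
    (by rw [hG, hTc]; exact hp) (by
      rintro _ ⟨_, ⟨i, rfl⟩, rfl⟩ (_ | b) hb hb'
      · simp at hb'
      · rcases b with j | j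
        · simp [T] at hb
        · rw [hG, hG]
          refine htu _ ?_ _ ?_
          · rw [← hf]; exact Multiset.mem_map_of_mem f (Finset.mem_univ i)
          · rw [← hg]; exact Multiset.mem_map_of_mem g (Finset.mem_univ j))
  have hnone : ∀ y, G'.Adj none y ↔ y ∈ T := fun y => by rw [← hN]; rfl
  refine ⟨Fin p ⊕ Fin q, inferInstance, Sum.elim (fun i => f i - 1) g, G'.comap some, ?_, ?_,
    .of_isEmpty⟩
  · rw [← Finset.univ_disjSum_univ, Finset.val_disjSum, Multiset.disjSum, Multiset.map_add,
      Multiset.map_map, Multiset.map_map, ← hf, ← hg, Multiset.map_map]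
    rfl
  · intro x
    have hs : some '' ((G'.comap some).neighborSet x) = G'.neighborSet (some x) \ {none} := by
      ext (_ | y) <;> simp
    rw [← Set.ncard_image_of_injective _ (Option.some_injective _), hs]
    rcases x with i | j
    · rw [Set.ncard_sdiff_singleton_of_mem, hG', hG]
      · rfl
      · exact SimpleGraph.Adj.symm ((hnone _).2 ⟨_, ⟨i, rfl⟩, rfl⟩)
    · rw [Set.sdiff_singleton_eq_self, hG', hG]
      · rfl
      · intro h
        have := (hnone _).1 (SimpleGraph.Adj.symm h)
        simp [T] at this

theorem Graphic.layOff_of_eq {s s' : Multiset ℕ} (h : Graphic s) (t u : Multiset ℕ)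
    (htu : ∀ a ∈ t, ∀ b ∈ u, b ≤ a) (h1 : s = Multiset.card t ::ₘ (t + u))
    (h2 : s' = t.map (· - 1) + u) : Graphic s' := by
  subst h1 h2
  exact h.layOff htu

theorem Graphic.even_sum {s : Multiset ℕ} (h : Graphic s) : Even s.sum := by
  classical
  obtain ⟨V, _, f, G, rfl, hd, -⟩ := h
  have : (Finset.univ.val.map f).sum = ∑ v, G.degree v := by
    refine Finset.sum_congr rfl fun v _ => ?_
    rw [← hd, ← G.card_neighborSet_eq_degree, ← Nat.card_coe_set_eq, Nat.card_eq_fintype_card]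
  rw [this, G.sum_degrees_eq_twice_card_edges]
  exact even_two_mul _

theorem Graphic.lt_card {s : Multiset ℕ} (h : Graphic s) {x : ℕ} (hx : x ∈ s) :
    x < Multiset.card s := by
  classical
  obtain ⟨V, _, f, G, rfl, hd, -⟩ := h
  obtain ⟨v, -, rfl⟩ := Multiset.mem_map.1 hx
  rw [← hd, ← Nat.card_coe_set_eq, Nat.card_eq_fintype_card, G.card_neighborSet_eq_degree]
  simpa using G.degree_lt_card_verts v

/-! ### The pattern graph and small explicit realizations -/

/-- Adjacency in index arithmetic, which makes it decidable. The seven edges are `inl 0`–`inl 2` and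
all six between the two summands, so only `inl 1` has degree two. -/
theorem graphK5SubA3_adj (x y : Fin 3 ⊕ Fin 2) :
    graphK5SubA3.Adj x y ↔ x ≠ y ∧ ¬ (Sum.elim
      (fun i => Sum.elim (fun j => i.val + 1 = j.val ∨ j.val + 1 = i.val) (fun _ => False))
      (fun i => Sum.elim (fun _ => False) (fun j => i ≠ j)) x y : Prop) := by
  rw [graphK5SubA3, SimpleGraph.deleteEdges_adj, SimpleGraph.mem_edgeSet, SimpleGraph.top_adj]
  refine and_congr_right fun _ => not_congr ?_
  rcases x with i | i <;> rcases y with j | j <;>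
    simp [graphA3, SimpleGraph.pathGraph_adj]

instance : DecidableRel graphK5SubA3.Adj := fun x y =>
  @decidable_of_iff' _ _ (graphK5SubA3_adj x y) (by
    rcases x with i | i <;> rcases y with j | j <;> simp only [Sum.elim_inl, Sum.elim_inr] <;>
      infer_instance)

theorem pot_of_degree {U V : Type} [Fintype V] {K : SimpleGraph U} (G : SimpleGraph V)
    [DecidableRel G.Adj] (hK : K.IsContained G) {s : Multiset ℕ}
    (hs : Finset.univ.val.map (fun v => G.degree v) = s) : Pot K s := by
  refine ⟨V, inferInstance, fun v => G.degree v, G, hs, fun v => ?_, hK⟩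
  rw [← Nat.card_coe_set_eq, Nat.card_eq_fintype_card, G.card_neighborSet_eq_degree]

/-- The multiset consisting of `a` threes, `b` twos and `c` ones. -/
def low (a b c : ℕ) : Multiset ℕ :=
  Multiset.replicate a 3 + Multiset.replicate b 2 + Multiset.replicate c 1

/-- The seeds on five vertices: `K₅ - A₃` itself and graphs restoring some of its missing edges. -/
theorem pot_3_low_3_1_0 : Pot graphK5SubA3 (3 ::ₘ low 3 1 0) :=
  pot_of_degree graphK5SubA3 .rfl (by decide)

theorem pot_4_low_4_0_0 : Pot graphK5SubA3 (4 ::ₘ low 4 0 0) :=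
  pot_of_degree (graphK5SubA3 ⊔ .fromRel fun x y => x = .inl 0 ∧ y = .inl 1) (.of_le le_sup_left)
    (by decide)

theorem pot_4_4_low_2_1_0 : Pot graphK5SubA3 ({4, 4} + low 2 1 0) :=
  pot_of_degree (graphK5SubA3 ⊔ .fromRel fun x y => x = .inr 0 ∧ y = .inr 1) (.of_le le_sup_left)
    (by decide)

theorem pot_4_4_4_low_2_0_0 : Pot graphK5SubA3 ({4, 4, 4} + low 2 0 0) :=
  pot_of_degree (.fromRel fun x _ => x ≠ .inl 1 ∧ x ≠ .inl 2)
    (.of_le (show ∀ x y, _ → _ by decide)) (by decide)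

theorem pot_4_4_4_4_4_low_0_0_0 : Pot graphK5SubA3 ({4, 4, 4, 4, 4} + low 0 0 0) :=
  pot_of_degree ⊤ (.of_le le_top) (by decide)

/-- From here on a new vertex is attached to an earlier realization. Most targets are sequences
whose standard residual is exceptional, so the new vertex is often joined to terms other than the
largest, such as a leaf; the rest are intermediate steps. -/
theorem pot_4_low_3_1_1 : Pot graphK5SubA3 (4 ::ₘ low 3 1 1) :=
  pot_3_low_3_1_0.addVertex_of_eq {3} (low 3 1 0) (by decide) (by decide)

theorem pot_4_low_3_2_1 : Pot graphK5SubA3 (4 ::ₘ low 3 2 1) :=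
  pot_4_low_3_1_1.addVertex_of_eq {1} ({4} + low 3 1 0) (by decide) (by decide)

theorem pot_4_low_4_1_0 : Pot graphK5SubA3 (4 ::ₘ low 4 1 0) :=
  pot_3_low_3_1_0.addVertex_of_eq {3, 2} (low 3 0 0) (by decide) (by decide)

theorem pot_4_low_5_0_1 : Pot graphK5SubA3 (4 ::ₘ low 5 0 1) :=
  pot_4_low_4_1_0.addVertex_of_eq {2} ({4} + low 4 0 0) (by decide) (by decide)

theorem pot_3_low_4_0_1 : Pot graphK5SubA3 (3 ::ₘ low 4 0 1) :=
  pot_3_low_3_1_0.addVertex_of_eq {2} (low 4 0 0) (by decide) (by decide)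

theorem pot_3_low_4_1_1 : Pot graphK5SubA3 (3 ::ₘ low 4 1 1) :=
  pot_3_low_4_0_1.addVertex_of_eq {1} (low 5 0 0) (by decide) (by decide)

theorem pot_4_low_4_2_0 : Pot graphK5SubA3 (4 ::ₘ low 4 2 0) :=
  pot_4_low_3_1_1.addVertex_of_eq {2, 1} ({4} + low 3 0 0) (by decide) (by decide)

theorem pot_4_4_low_2_3_0 : Pot graphK5SubA3 ({4, 4} + low 2 3 0) :=
  pot_4_low_3_1_1.addVertex_of_eq {3, 1} ({4} + low 2 1 0) (by decide) (by decide)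

theorem pot_4_4_low_4_1_0 : Pot graphK5SubA3 ({4, 4} + low 4 1 0) :=
  pot_4_low_4_1_0.addVertex_of_eq {3, 2} ({4} + low 3 0 0) (by decide) (by decide)

theorem pot_5_4_low_3_1_0 : Pot graphK5SubA3 ({5, 4} + low 3 1 0) :=
  pot_4_4_low_2_1_0.addVertex_of_eq {4, 2} ({4} + low 2 0 0) (by decide) (by decide)

theorem pot_6_4_low_4_1_0 : Pot graphK5SubA3 ({6, 4} + low 4 1 0) :=
  pot_5_4_low_3_1_0.addVertex_of_eq {5, 2} ({4} + low 3 0 0) (by decide) (by decide)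

theorem pot_4_4_4_low_4_0_0 : Pot graphK5SubA3 ({4, 4, 4} + low 4 0 0) :=
  pot_4_low_4_1_0.addVertex_of_eq {3, 3, 2} ({4} + low 2 0 0) (by decide) (by decide)

theorem pot_6_4_4_low_4_0_0 : Pot graphK5SubA3 ({6, 4, 4} + low 4 0 0) :=
  pot_5_4_low_3_1_0.addVertex_of_eq {5, 3, 2} ({4} + low 2 0 0) (by decide) (by decide)

theorem pot_4_low_3_3_1 : Pot graphK5SubA3 (4 ::ₘ low 3 3 1) :=
  pot_4_low_3_2_1.addVertex_of_eq {1} ({4} + low 3 2 0) (by decide) (by decide)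

theorem pot_4_low_5_1_1 : Pot graphK5SubA3 (4 ::ₘ low 5 1 1) :=
  pot_4_low_5_0_1.addVertex_of_eq {1} ({4} + low 5 0 0) (by decide) (by decide)

theorem pot_5_low_6_0_1 : Pot graphK5SubA3 (5 ::ₘ low 6 0 1) :=
  pot_4_low_3_2_1.addVertex_of_eq {4, 2, 2} (low 3 0 1) (by decide) (by decide)

theorem pot_3_low_4_2_1 : Pot graphK5SubA3 (3 ::ₘ low 4 2 1) :=
  pot_3_low_4_1_1.addVertex_of_eq {1} (low 5 1 0) (by decide) (by decide)

theorem pot_4_low_4_3_0 : Pot graphK5SubA3 (4 ::ₘ low 4 3 0) :=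
  pot_3_low_4_1_1.addVertex_of_eq {3, 1} (low 4 1 0) (by decide) (by decide)

theorem pot_4_low_6_1_0 : Pot graphK5SubA3 (4 ::ₘ low 6 1 0) :=
  pot_4_low_4_2_0.addVertex_of_eq {2, 2} ({4} + low 4 0 0) (by decide) (by decide)

theorem pot_3_low_5_2_0 : Pot graphK5SubA3 (3 ::ₘ low 5 2 0) :=
  pot_3_low_4_1_1.addVertex_of_eq {2, 1} (low 5 0 0) (by decide) (by decide)

theorem pot_5_low_3_4_0 : Pot graphK5SubA3 (5 ::ₘ low 3 4 0) :=
  pot_4_low_3_2_1.addVertex_of_eq {4, 1} (low 3 2 0) (by decide) (by decide)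

theorem pot_4_4_low_5_0_1 : Pot graphK5SubA3 ({4, 4} + low 5 0 1) :=
  pot_4_4_low_4_1_0.addVertex_of_eq {2} ({4, 4} + low 4 0 0) (by decide) (by decide)

theorem pot_4_4_low_2_4_0 : Pot graphK5SubA3 ({4, 4} + low 2 4 0) :=
  pot_4_low_3_2_1.addVertex_of_eq {3, 1} ({4} + low 2 2 0) (by decide) (by decide)

theorem pot_4_4_low_4_2_0 : Pot graphK5SubA3 ({4, 4} + low 4 2 0) :=
  pot_4_low_4_2_0.addVertex_of_eq {3, 2} ({4} + low 3 1 0) (by decide) (by decide)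

theorem pot_5_4_low_5_1_0 : Pot graphK5SubA3 ({5, 4} + low 5 1 0) :=
  pot_4_4_low_4_1_0.addVertex_of_eq {4, 2} ({4} + low 4 0 0) (by decide) (by decide)

theorem pot_7_4_low_5_1_0 : Pot graphK5SubA3 ({7, 4} + low 5 1 0) :=
  pot_6_4_low_4_1_0.addVertex_of_eq {6, 2} ({4} + low 4 0 0) (by decide) (by decide)

theorem pot_4_4_4_low_4_1_0 : Pot graphK5SubA3 ({4, 4, 4} + low 4 1 0) :=
  pot_4_4_low_4_1_0.addVertex_of_eq {3, 2} ({4, 4} + low 3 0 0) (by decide) (by decide)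

theorem pot_4_4_low_6_0_0 : Pot graphK5SubA3 ({4, 4} + low 6 0 0) :=
  pot_4_low_4_2_0.addVertex_of_eq {3, 2, 2} ({4} + low 3 0 0) (by decide) (by decide)

theorem pot_5_4_4_low_5_0_0 : Pot graphK5SubA3 ({5, 4, 4} + low 5 0 0) :=
  pot_4_4_low_4_1_0.addVertex_of_eq {4, 3, 2} ({4} + low 3 0 0) (by decide) (by decide)

theorem pot_7_4_4_low_5_0_0 : Pot graphK5SubA3 ({7, 4, 4} + low 5 0 0) :=
  pot_6_4_low_4_1_0.addVertex_of_eq {6, 3, 2} ({4} + low 3 0 0) (by decide) (by decide)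

theorem pot_4_4_4_4_low_4_0_0 : Pot graphK5SubA3 ({4, 4, 4, 4} + low 4 0 0) :=
  pot_4_4_low_4_1_0.addVertex_of_eq {3, 3, 2} ({4, 4} + low 2 0 0) (by decide) (by decide)

theorem pot_4_low_6_0_2 : Pot graphK5SubA3 (4 ::ₘ low 6 0 2) :=
  pot_4_low_5_1_1.addVertex_of_eq {2} ({4} + low 5 0 1) (by decide) (by decide)

theorem pot_4_low_7_0_1 : Pot graphK5SubA3 (4 ::ₘ low 7 0 1) :=
  pot_4_low_6_1_0.addVertex_of_eq {2} ({4} + low 6 0 0) (by decide) (by decide)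

theorem pot_5_low_3_5_0 : Pot graphK5SubA3 (5 ::ₘ low 3 5 0) :=
  pot_4_low_3_3_1.addVertex_of_eq {4, 1} (low 3 3 0) (by decide) (by decide)

theorem pot_4_4_low_6_1_0 : Pot graphK5SubA3 ({4, 4} + low 6 1 0) :=
  pot_4_4_low_4_2_0.addVertex_of_eq {2, 2} ({4, 4} + low 4 0 0) (by decide) (by decide)

theorem pot_4_4_4_low_6_0_0 : Pot graphK5SubA3 ({4, 4, 4} + low 6 0 0) :=
  pot_4_4_low_4_2_0.addVertex_of_eq {3, 2, 2} ({4, 4} + low 3 0 0) (by decide) (by decide)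

/-! ### Laying off and restoring terms below a single head -/

theorem low_succ_three (a b c : ℕ) : low (a + 1) b c = 3 ::ₘ low a b c := by
  simp [low, Multiset.replicate_succ]

theorem low_succ_two (a b c : ℕ) : low a (b + 1) c = 2 ::ₘ low a b c := by
  simp [low, Multiset.replicate_succ]

theorem low_succ_one (a b c : ℕ) : low a b (c + 1) = 1 ::ₘ low a b c := by
  simp [low, Multiset.replicate_succ]

/-- When laying off lowers a head of three to two, another three takes over as head. -/
theorem two_cons_low (a b c : ℕ) : 2 ::ₘ low (a + 1) b c = 3 ::ₘ low a (b + 1) c := by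
  rw [low_succ_three, low_succ_two, Multiset.cons_swap]

theorem le_three_of_mem_low {a b c y : ℕ} (h : y ∈ low a b c) : y ≤ 3 := by
  simp only [low, Multiset.mem_add, Multiset.mem_replicate] at h
  omega

theorem card_low (a b c : ℕ) : Multiset.card (low a b c) = a + b + c := by
  simp [low]

theorem sum_low (a b c : ℕ) : (low a b c).sum = 3 * a + 2 * b + c := by
  simp [low, mul_comm]

section Cons

variable {U : Type} {K : SimpleGraph U} {x a b c : ℕ}

/-- This and the next two undo `Graphic.cons_low_sub_one`, `Graphic.cons_low_sub_two` and
`Graphic.cons_low_sub_three`: the restored vertex has degree one, two or three. -/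
theorem Pot.cons_low_add_one (h : Pot K (x ::ₘ low a b c)) :
    Pot K ((x + 1) ::ₘ low a b (c + 1)) := by
  refine h.addVertex_of_eq {x} (low a b c) rfl ?_
  simp only [low_succ_one, ← Multiset.singleton_add, Multiset.card_singleton,
    Multiset.map_singleton]
  abel

theorem Pot.cons_low_add_two (h : Pot K (x ::ₘ low a (b + 1) c)) :
    Pot K ((x + 1) ::ₘ low (a + 1) (b + 1) c) := by
  refine h.addVertex_of_eq {x, 2} (low a b c) ?_ ?_
  · simp only [low_succ_two, ← Multiset.singleton_add, Multiset.insert_eq_cons]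
    abel
  · simp only [low_succ_two, low_succ_three, ← Multiset.singleton_add, Multiset.insert_eq_cons,
      Multiset.map_add, Multiset.map_singleton, Multiset.card_add, Multiset.card_singleton]
    abel

theorem Pot.cons_low_add_three (h : Pot K (x ::ₘ low a (b + 2) c)) :
    Pot K ((x + 1) ::ₘ low (a + 3) b c) := by
  refine h.addVertex_of_eq {x, 2, 2} (low a b c) ?_ ?_
  · simp only [low_succ_two, ← Multiset.singleton_add, Multiset.insert_eq_cons]
    abel
  · simp only [low_succ_three, ← Multiset.singleton_add, Multiset.insert_eq_cons,
      Multiset.map_add, Multiset.map_singleton, Multiset.card_add, Multiset.card_singleton]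
    abel

/-- Attaching a triangle at a vertex. -/
theorem Pot.cons_add_triangle {s : Multiset ℕ} (h : Pot K (x ::ₘ s)) :
    Pot K ((x + 2) ::ₘ 2 ::ₘ 2 ::ₘ s) := by
  have h1 : Pot K ((x + 1) ::ₘ 1 ::ₘ s) := by
    refine h.addVertex_of_eq {x} s rfl ?_
    simp only [← Multiset.singleton_add, Multiset.card_singleton, Multiset.map_singleton]
    abel
  refine h1.addVertex_of_eq {x + 1, 1} s ?_ ?_
  · simp only [← Multiset.singleton_add, Multiset.insert_eq_cons]
    abel
  · simp only [← Multiset.singleton_add, Multiset.insert_eq_cons,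
      Multiset.map_add, Multiset.map_singleton, Multiset.card_add, Multiset.card_singleton]
    abel

theorem Pot.cons_low_add_triangle (h : Pot K (x ::ₘ low a b c)) :
    Pot K ((x + 2) ::ₘ low a (b + 2) c) := by
  simpa only [low_succ_two] using h.cons_add_triangle

/-- The bound on `x` makes the head at least three, hence a largest term. -/
theorem Graphic.cons_low_sub_one (h : Graphic ((x + 1) ::ₘ low a b (c + 1))) (hx : 2 ≤ x) :
    Graphic (x ::ₘ low a b c) := by
  refine h.layOff_of_eq {x + 1} (low a b c) ?_ ?_ (by simp)
  · intro y hy z hz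
    have := le_three_of_mem_low hz
    rw [Multiset.mem_singleton] at hy
    omega
  · simp only [low_succ_one, ← Multiset.singleton_add, Multiset.card_singleton]
    abel

theorem Graphic.cons_low_sub_two (h : Graphic ((x + 1) ::ₘ low (a + 1) (b + 1) c)) (hx : 2 ≤ x) :
    Graphic (x ::ₘ low a (b + 1) c) := by
  refine h.layOff_of_eq {x + 1, 3} (low a b c) ?_ ?_ ?_
  · intro y hy z hz
    have := le_three_of_mem_low hz
    simp only [Multiset.insert_eq_cons, Multiset.mem_cons, Multiset.mem_singleton] at hy
    omega
  · simp only [low_succ_two, low_succ_three, ← Multiset.singleton_add, Multiset.insert_eq_cons,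
      Multiset.card_add, Multiset.card_singleton]
    abel
  · simp only [low_succ_two, ← Multiset.singleton_add, Multiset.insert_eq_cons, Multiset.map_add,
      Multiset.map_singleton, Nat.add_sub_cancel, Nat.reduceSub]
    abel

theorem Graphic.cons_low_sub_three (h : Graphic ((x + 1) ::ₘ low (a + 3) b c)) (hx : 2 ≤ x) :
    Graphic (x ::ₘ low a (b + 2) c) := by
  refine h.layOff_of_eq {x + 1, 3, 3} (low a b c) ?_ ?_ ?_
  · intro y hy z hz
    have := le_three_of_mem_low hz
    simp only [Multiset.insert_eq_cons, Multiset.mem_cons, Multiset.mem_singleton] at hy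
    omega
  · simp only [low_succ_three, ← Multiset.singleton_add, Multiset.insert_eq_cons,
      Multiset.card_add, Multiset.card_singleton]
    abel
  · simp only [low_succ_two, ← Multiset.singleton_add, Multiset.insert_eq_cons, Multiset.map_add,
      Multiset.map_singleton, Nat.add_sub_cancel, Nat.reduceSub]
    abel

end Cons

/-! ### Sequences with at most one term above three -/

/-- The parameters of the sequences `(x, 3 ^ a, 2 ^ b, 1 ^ c)` excluded in the characterization of
potentially `K₅ - A₃`-graphic sequences. -/
inductive Exceptional (x a b c : ℕ) : Prop
  | dominating_three (h : x = a + b + c ∧ a = 3 ∧ 2 ≤ b ∧ b % 2 = 0)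
  | dominating_five (h : x = a + b + c ∧ a = 5 ∧ b = 0)
  | dominating_six (h : x = a + b + c ∧ a = 6 ∧ b = 0)
  | three_four_two_two (h : x = 3 ∧ a = 3 ∧ b = 2 ∧ c = 0)
  | three_six (h : x = 3 ∧ a = 5 ∧ b = 0 ∧ c = 0)
  | three_four_two_three (h : x = 3 ∧ a = 3 ∧ b = 3 ∧ c = 0)
  | three_six_two (h : x = 3 ∧ a = 5 ∧ b = 1 ∧ c = 0)
  | four_three_six (h : x = 4 ∧ a = 6 ∧ b = 0 ∧ c = 0)
  | three_seven_one (h : x = 3 ∧ a = 6 ∧ b = 0 ∧ c = 1)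
  | three_eight (h : x = 3 ∧ a = 7 ∧ b = 0 ∧ c = 0)

/-- A copy of `K₅ - A₃` beside a disjoint edge; joining each new vertex to a leaf lengthens that
edge into a path. -/
theorem pot_low_four_add_one_one (b : ℕ) : Pot graphK5SubA3 (low 4 (b + 1) 2) := by
  induction b with
  | zero =>
    have h : Pot graphK5SubA3 (low 4 1 0) := by
      rw [low_succ_three]; exact pot_3_low_3_1_0
    have h0 : Pot graphK5SubA3 (0 ::ₘ low 4 1 0) := h.addVertex_of_eq 0 _ (zero_add _).symm (by simp)
    exact h0.addVertex_of_eq {0} (low 4 1 0) rfl (by decide)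
  | succ b ih =>
    refine ih.addVertex_of_eq {1} (low 4 (b + 1) 1) ?_ ?_
    · rw [low_succ_one _ _ 1]; rfl
    · rw [low_succ_two _ (b + 1), low_succ_one _ _ 1, Multiset.cons_swap]; rfl

/-- Without ones, the extra twos form a cycle closed up from a path, which needs at least three
vertices; this is why `b = 2` and `b = 3` are barred. Further pairs of ones are disjoint edges. -/
theorem pot_low_four {b c : ℕ} (hb : 1 ≤ b) (hc : c % 2 = 0) (h : 2 ≤ c ∨ b = 1 ∨ 4 ≤ b) :
    Pot graphK5SubA3 (low 4 b c) := by
  induction c using Nat.strong_induction_on with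
  | _ c ih =>
    obtain rfl | rfl | hc4 : c = 0 ∨ c = 2 ∨ 4 ≤ c := by omega
    · obtain rfl | hb4 : b = 1 ∨ 4 ≤ b := by omega
      · rw [low_succ_three]; exact pot_3_low_3_1_0
      · obtain ⟨b, rfl⟩ := Nat.exists_eq_add_of_le hb4
        have h1 := pot_low_four_add_one_one b
        refine h1.addVertex_of_eq {1, 1} (low 4 (b + 1) 0) ?_ ?_
        · rw [low_succ_one _ _ 1, low_succ_one]; rfl
        · rw [show 4 + b = b + 1 + 1 + 1 + 1 by omega, low_succ_two _ (b + 1 + 1 + 1),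
            low_succ_two _ (b + 1 + 1), low_succ_two _ (b + 1)]
          rfl
    · obtain ⟨b, rfl⟩ := Nat.exists_eq_add_of_le' hb
      exact pot_low_four_add_one_one b
    · obtain ⟨c, rfl⟩ := Nat.exists_eq_add_of_le' hc4
      have h1 := ih (c + 2) (by omega) (by omega) (by omega)
      have h0 : Pot graphK5SubA3 (0 ::ₘ low 4 b (c + 2)) :=
        h1.addVertex_of_eq 0 _ (zero_add _).symm (by simp)
      refine h0.addVertex_of_eq {0} (low 4 b (c + 2)) rfl ?_
      rw [low_succ_one _ _ (c + 3), low_succ_one _ _ (c + 2)]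
      rfl

/-- Triangles at the head are peeled off until the head is three. Two sequences with head five would
peel down to the exceptional `(3^4,2^2)` and `(3^4,2^3)`, so they are supplied directly. -/
theorem pot_cons_low_three {x b : ℕ} (hx : 3 ≤ x) (hodd : x % 2 = 1) (hxb : x ≤ b + 2)
    (hne : ¬ (x = 3 ∧ (b = 2 ∨ b = 3))) : Pot graphK5SubA3 (x ::ₘ low 3 b 0) := by
  induction x using Nat.strong_induction_on generalizing b with
  | _ x ih =>
    obtain rfl | hx5 : x = 3 ∨ 5 ≤ x := by omega
    · rw [← low_succ_three]
      exact pot_low_four (by omega) rfl (by omega)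
    · by_cases hex : x = 5 ∧ (b = 4 ∨ b = 5)
      · obtain ⟨rfl, rfl | rfl⟩ := hex
        · exact pot_5_low_3_4_0
        · exact pot_5_low_3_5_0
      · obtain ⟨x, rfl⟩ := Nat.exists_eq_add_of_le' (show 2 ≤ x by omega)
        obtain ⟨b, rfl⟩ := Nat.exists_eq_add_of_le' (show 2 ≤ b by omega)
        exact (ih x (by omega) (by omega) (by omega) (by omega) (by omega)).cons_low_add_triangle

/-- These are the sequences without ones whose residual falls in the family `dominating_three`; they
arise by hanging triangles on the vertex of degree four. -/
theorem pot_cons_low_four (m : ℕ) : Pot graphK5SubA3 ((2 * m + 4) ::ₘ low 4 (2 * m) 0) := by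
  induction m with
  | zero => exact pot_4_low_4_0_0
  | succ m ih => exact ih.cons_low_add_triangle

/-- The characterization for sequences with at most one term exceeding three. -/
theorem pot_cons_low {x a b c : ℕ} (hG : Graphic (x ::ₘ low a b c)) (hx : 3 ≤ x) (ha : 3 ≤ a)
    (hab : 4 ≤ a + b) (hE : ¬ Exceptional x a b c) : Pot graphK5SubA3 (x ::ₘ low a b c) := by
  induction hN : a + b + c using Nat.strong_induction_on generalizing x a b c with
  | _ N ih =>
    have hev := hG.even_sum
    rw [Multiset.sum_cons, sum_low, Nat.even_iff] at hev
    have hlt := hG.lt_card (Multiset.mem_cons_self _ _)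
    rw [Multiset.card_cons, card_low] at hlt
    obtain ⟨x, rfl⟩ := Nat.exists_eq_add_of_le' (show 1 ≤ x by omega)
    rcases c with _ | c
    · rcases b with _ | b
      · by_cases ha4 : a = 4
        · subst ha4
          obtain rfl : x = 3 := by omega
          exact pot_4_low_4_0_0
        obtain ⟨a, rfl⟩ := Nat.exists_eq_add_of_le' (show 3 ≤ a by omega)
        -- With five threes and nothing else below the head, parity and size leave only heads three
        -- and five, both exceptional.
        have ha5 : a ≠ 2 := fun h => by
          subst h
          obtain rfl | rfl : x = 2 ∨ x = 4 := by omega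
          · exact hE (.three_six (by omega))
          · exact hE (.dominating_five (by omega))
        have hG' := hG.cons_low_sub_three (by omega)
        refine Pot.cons_low_add_three ?_
        obtain rfl | hx3 : x = 2 ∨ 3 ≤ x := by omega
        · obtain ⟨a, rfl⟩ := Nat.exists_eq_add_of_le' (show 1 ≤ a by omega)
          rw [two_cons_low] at hG' ⊢
          refine ih _ (by omega) hG' le_rfl (by omega) (by omega) (fun h => ?_) rfl
          rcases h with h | h | h | h | h | h | h | h | h | h <;>
            first | omega | exact hE (.three_eight (by omega))
        · refine ih _ (by omega) hG' hx3 (by omega) (by omega) (fun h => ?_) rfl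
          rcases h with h | h | h | h | h | h | h | h | h | h <;>
            first
            | omega
            | exact hE (.dominating_six (by omega))
            | exact hE (.four_three_six (by omega))
      · by_cases ha3 : a = 3
        · subst ha3
          have h1 : x ≠ b + 3 := fun h => hE (.dominating_three (by omega))
          refine pot_cons_low_three hx (by omega) (by omega) ?_
          rintro ⟨hx, hb | hb⟩
          · exact hE (.three_four_two_two (by omega))
          · exact hE (.three_four_two_three (by omega))
        obtain ⟨a, rfl⟩ := Nat.exists_eq_add_of_le' (show 1 ≤ a by omega)
        have hG' := hG.cons_low_sub_two (by omega)
        obtain rfl | hx3 : x = 2 ∨ 3 ≤ x := by omega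
        · obtain ⟨a, rfl⟩ := Nat.exists_eq_add_of_le' (show 1 ≤ a by omega)
          -- The residual of `(3^6,2^2)` is the exceptional `(3^4,2^3)`.
          by_cases hex : a = 3 ∧ b = 1
          · obtain ⟨rfl, rfl⟩ := hex
            exact pot_3_low_5_2_0
          rw [two_cons_low] at hG'
          refine Pot.cons_low_add_two ?_
          rw [two_cons_low]
          refine ih _ (by omega) hG' le_rfl (by omega) (by omega) (fun h => ?_) rfl
          rcases h with h | h | h | h | h | h | h | h | h | h <;>
            first | omega | exact hE (.three_six_two (by omega))
        -- Four exceptional residuals are possible here: one infinite family and three sporadic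
        -- sequences, and none comes from an exceptional original.
        · by_cases h : Exceptional x a (b + 1) 0
          · rcases h with h | h | h | h | h | h | h | h | h | h <;> try omega
            · obtain ⟨rfl, rfl, -, hb⟩ := h
              obtain ⟨m, hm⟩ : ∃ m, b + 1 = 2 * m := ⟨(b + 1) / 2, by omega⟩
              rw [hm, show 3 + 2 * m + 0 + 1 = 2 * m + 4 by omega]
              exact pot_cons_low_four m
            · obtain ⟨rfl, rfl, hb, -⟩ := h
              obtain rfl : b = 1 := by omega
              exact pot_4_low_4_2_0
            · obtain ⟨rfl, rfl, hb, -⟩ := h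
              obtain rfl : b = 2 := by omega
              exact pot_4_low_4_3_0
            · obtain ⟨rfl, rfl, hb, -⟩ := h
              obtain rfl : b = 0 := by omega
              exact pot_4_low_6_1_0
          · exact Pot.cons_low_add_two (ih _ (by omega) hG' hx3 (by omega) (by omega) h rfl)
    · have hG' := hG.cons_low_sub_one (by omega)
      obtain rfl | hx3 : x = 2 ∨ 3 ≤ x := by omega
      · obtain ⟨a, rfl⟩ := Nat.exists_eq_add_of_le' (show 1 ≤ a by omega)
        by_cases ha2 : a = 2
        · subst ha2
          rw [← low_succ_three]
          refine pot_low_four ?_ ?_ ?_ <;> omega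
        by_cases h : Exceptional 3 a (b + 1) c
        · rcases h with h | h | h | h | h | h | h | h | h | h <;> try omega
          · obtain ⟨-, rfl, hb, rfl⟩ := h
            obtain rfl : b = 1 := by omega
            exact pot_3_low_4_1_1
          · obtain ⟨-, rfl, hb, rfl⟩ := h
            obtain rfl : b = 2 := by omega
            exact pot_3_low_4_2_1
          · exact absurd (.three_seven_one (by omega)) hE
        · refine Pot.cons_low_add_one ?_
          rw [two_cons_low] at hG' ⊢
          exact ih _ (by omega) hG' le_rfl (by omega) (by omega) h rfl
      -- Restoring a leaf at a dominating head keeps the head dominating, so the three families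
      -- persist; the sporadic residuals yield realizable sequences.
      · by_cases h : Exceptional x a b c
        · rcases h with h | h | h | h | h | h | h | h | h | h
          · exact absurd (.dominating_three (by omega)) hE
          · exact absurd (.dominating_five (by omega)) hE
          · exact absurd (.dominating_six (by omega)) hE
          all_goals obtain ⟨rfl, rfl, rfl, rfl⟩ := h
          · exact pot_4_low_3_2_1
          · exact pot_4_low_5_0_1
          · exact pot_4_low_3_3_1
          · exact pot_4_low_5_1_1
          · exact pot_5_low_6_0_1
          · exact pot_4_low_6_0_2
          · exact pot_4_low_7_0_1
        · exact Pot.cons_low_add_one (ih _ (by omega) hG' hx3 ha hab h rfl)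

/-! ### Sequences with at least two terms above three -/

theorem Multiset.exists_cons_max {m : Multiset ℕ} (hm : 1 ≤ Multiset.card m) :
    ∃ d m', m = d ::ₘ m' ∧ ∀ y ∈ m', y ≤ d := by
  have hne : m ≠ 0 := by rintro rfl; simp at hm
  obtain ⟨d, hd, hmax⟩ := Multiset.exists_max_image id hne
  obtain ⟨m', rfl⟩ := Multiset.exists_cons_of_mem hd
  exact ⟨d, m', rfl, fun y hy => hmax y (Multiset.mem_cons_of_mem hy)⟩

theorem Multiset.exists_cons_min {m : Multiset ℕ} (hm : 1 ≤ Multiset.card m) :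
    ∃ d m', m = d ::ₘ m' ∧ ∀ y ∈ m', d ≤ y := by
  have hne : m ≠ 0 := by rintro rfl; simp at hm
  obtain ⟨d, hd, hmin⟩ := Multiset.exists_min_image id hne
  obtain ⟨m', rfl⟩ := Multiset.exists_cons_of_mem hd
  exact ⟨d, m', rfl, fun y hy => hmin y (Multiset.mem_cons_of_mem hy)⟩

theorem Multiset.exists_add_top (s : Multiset ℕ) {k : ℕ} (hk : k ≤ Multiset.card s) :
    ∃ t u, s = t + u ∧ Multiset.card t = k ∧ ∀ a ∈ t, ∀ b ∈ u, b ≤ a := by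
  induction k with
  | zero => exact ⟨0, s, by simp, by simp, by simp⟩
  | succ k ih =>
    obtain ⟨t, u, rfl, rfl, h⟩ := ih (by omega)
    obtain ⟨d, u', rfl, hu⟩ := Multiset.exists_cons_max (m := u) (by
      rw [Multiset.card_add] at hk; omega)
    refine ⟨d ::ₘ t, u', by simp, by simp, ?_⟩
    intro a ha b hb
    rcases Multiset.mem_cons.1 ha with rfl | ha
    · exact hu b hb
    · exact h a ha b (Multiset.mem_cons_of_mem hb)

/-- An exceptional residual has at most one term above three. Hence at most one large term `m`
escaped the laying off, which pins down the original sequence. -/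
theorem Multiset.eq_zero_or_singleton_of_add_eq {l m : Multiset ℕ} {x k : ℕ}
    (hm : ∀ y ∈ m, 4 ≤ y) (h : l + m = x ::ₘ Multiset.replicate k 3) :
    m = 0 ∧ l = x ::ₘ Multiset.replicate k 3 ∨ m = {x} ∧ l = Multiset.replicate k 3 := by
  have h1 : m ≤ {x} := by
    have h2 : m ≤ (x ::ₘ Multiset.replicate k 3).filter (4 ≤ ·) := by
      rw [Multiset.le_filter, ← h]
      exact ⟨Multiset.le_add_left _ _, hm⟩
    rw [← Multiset.singleton_add, Multiset.filter_add,
      Multiset.filter_eq_nil.2 (show ∀ a ∈ Multiset.replicate k 3, ¬ 4 ≤ a by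
        intro a ha; rw [Multiset.eq_of_mem_replicate ha]; decide), add_zero] at h2
    exact h2.trans (Multiset.filter_le _ _)
  rcases Multiset.le_singleton.1 h1 with rfl | rfl
  · exact .inl ⟨rfl, by simpa using h⟩
  · refine .inr ⟨rfl, ?_⟩
    rw [add_comm, Multiset.singleton_add] at h
    exact (Multiset.cons_inj_right x).1 h

/-- Large terms that have dropped to three are absorbed into the low part. -/
theorem Multiset.add_low_of_three_le {l : Multiset ℕ} (hl : ∀ y ∈ l, 3 ≤ y) :
    ∃ m k, l = m + Multiset.replicate k 3 ∧ (∀ y ∈ m, 4 ≤ y) ∧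
      ∀ a b c, l + low a b c = m + low (k + a) b c := by
  have hl' : l.filter (4 ≤ ·) + Multiset.replicate (Multiset.card (l.filter (¬ 4 ≤ ·))) 3 = l := by
    conv_rhs => rw [← Multiset.filter_add_not (4 ≤ ·) l]
    congr 1
    refine (Multiset.eq_replicate_card.2 fun y hy => ?_).symm
    rw [Multiset.mem_filter] at hy
    have := hl y hy.1
    omega
  refine ⟨_, _, hl'.symm, fun y hy => (Multiset.mem_filter.1 hy).2, fun a b c => ?_⟩
  conv_lhs => rw [← hl']
  rw [low, low, Multiset.replicate_add]
  abel

/-- Reduction step for sequences with at least two terms exceeding three: a shorter sequence is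
potentially `K₅ - A₃`-graphic or falls into the explicit exceptions. -/
theorem pot_or_exceptional {N : ℕ}
    (ih : ∀ (m : Multiset ℕ) (a b c : ℕ), Multiset.card m + a + b + c < N → (∀ y ∈ m, 4 ≤ y) →
      2 ≤ Multiset.card m → 4 ≤ Multiset.card m + a → 5 ≤ Multiset.card m + a + b →
      Graphic (m + low a b c) → Pot graphK5SubA3 (m + low a b c))
    {l : Multiset ℕ} {a b c : ℕ} (hl : ∀ y ∈ l, 3 ≤ y) (hl1 : 1 ≤ Multiset.card l)
    (hN : Multiset.card l + a + b + c < N) (h4 : 4 ≤ Multiset.card l + a)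
    (h5 : 5 ≤ Multiset.card l + a + b) (hG : Graphic (l + low a b c)) :
    Pot graphK5SubA3 (l + low a b c) ∨
      ∃ x k, l = x ::ₘ Multiset.replicate k 3 ∧ Exceptional x (k + a) b c := by
  obtain ⟨m, k, rfl, hm, hlow⟩ := Multiset.add_low_of_three_le hl
  rw [Multiset.card_add, Multiset.card_replicate] at *
  rw [hlow] at hG ⊢
  by_cases hm2 : 2 ≤ Multiset.card m
  · exact .inl (ih m _ _ _ (by omega) hm hm2 (by omega) (by omega) hG)
  -- If no term exceeds three, one of the threes serves as head.
  · obtain ⟨x, k', hx, hk, heq⟩ : ∃ x k', 3 ≤ x ∧ m + Multiset.replicate k 3 =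
        x ::ₘ Multiset.replicate k' 3 ∧ m + low (k + a) b c = x ::ₘ low (k' + a) b c := by
      obtain h0 | h1 : Multiset.card m = 0 ∨ Multiset.card m = 1 := by omega
      · obtain ⟨k, rfl⟩ := Nat.exists_eq_add_of_le' (show 1 ≤ k by omega)
        rw [Multiset.card_eq_zero.1 h0]
        refine ⟨3, k, le_rfl, by rw [zero_add, Multiset.replicate_succ], ?_⟩
        rw [zero_add, show k + 1 + a = k + a + 1 by omega, low_succ_three]
      · obtain ⟨y, rfl⟩ := Multiset.card_eq_one.1 h1
        have := hm y (Multiset.mem_singleton_self y)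
        exact ⟨y, k, by omega, rfl, rfl⟩
    have hc := congrArg Multiset.card hk
    rw [Multiset.card_add, Multiset.card_cons, Multiset.card_replicate,
      Multiset.card_replicate] at hc
    rw [heq] at hG ⊢
    by_cases hE : Exceptional x (k' + a) b c
    · exact .inr ⟨x, k', hk, hE⟩
    · exact .inl (pot_cons_low hG hx (by omega) (by omega) hE)

/-- Triangles hung on a vertex of degree four; needed when the residual lies in the family
`dominating_three`. -/
theorem pot_cons_four_low (m : ℕ) :
    Pot graphK5SubA3 ((2 * m + 4) ::ₘ {4} + low 2 (2 * m + 1) 0) := by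
  induction m with
  | zero => exact pot_4_4_low_2_1_0
  | succ m ih =>
    rw [Multiset.cons_add] at ih ⊢
    have := ih.cons_add_triangle
    rw [show 2 * (m + 1) + 1 = 2 * m + 1 + 1 + 1 by ring, low_succ_two, low_succ_two,
      Multiset.add_cons, Multiset.add_cons]
    exact this

theorem pot_add_low_of_card_eq_five {m : Multiset ℕ} {a b c : ℕ} (hm : ∀ y ∈ m, 4 ≤ y)
    (h2 : 2 ≤ Multiset.card m) (h4 : 4 ≤ Multiset.card m + a)
    (h5 : 5 ≤ Multiset.card m + a + b) (hN : Multiset.card m + a + b + c = 5)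
    (hG : Graphic (m + low a b c)) : Pot graphK5SubA3 (m + low a b c) := by
  obtain rfl : c = 0 := by omega
  have hm4 : m = Multiset.replicate (Multiset.card m) 4 := by
    refine Multiset.eq_replicate_card.2 fun y hy => ?_
    have h1 := hG.lt_card (Multiset.mem_add.2 (.inl hy))
    have := hm y hy
    rw [Multiset.card_add, card_low] at h1
    omega
  have hev := hG.even_sum
  rw [Multiset.sum_add, sum_low, hm4, Multiset.sum_replicate, smul_eq_mul, Nat.even_iff] at hev
  generalize Multiset.card m = j at *
  subst hm4
  have : (j = 2 ∧ a = 2 ∧ b = 1) ∨ (j = 4 ∧ a = 0 ∧ b = 1) ∨ (j = 3 ∧ a = 2 ∧ b = 0) ∨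
    (j = 5 ∧ a = 0 ∧ b = 0) := by omega
  rcases this with ⟨rfl, rfl, rfl⟩ | ⟨rfl, rfl, rfl⟩ | ⟨rfl, rfl, rfl⟩ | ⟨rfl, rfl, rfl⟩
  · exact pot_4_4_low_2_1_0
  -- `(4^4,2)` passes the parity test but is not graphic: removing the two leaves a four on four
  -- vertices.
  · have hG' : Graphic {3, 3, 4, 4} :=
      hG.layOff_of_eq {4, 4} {4, 4} (by decide) (by decide) (by decide)
    exact absurd (hG'.lt_card (x := 4) (by decide)) (by decide)
  · exact pot_4_4_4_low_2_0_0
  · exact pot_4_4_4_4_4_low_0_0_0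

/-- Sequences with at least two terms exceeding three are never exceptional. -/
theorem pot_add_low {m : Multiset ℕ} {a b c : ℕ} (hm : ∀ y ∈ m, 4 ≤ y)
    (h2 : 2 ≤ Multiset.card m) (h4 : 4 ≤ Multiset.card m + a)
    (h5 : 5 ≤ Multiset.card m + a + b) (hG : Graphic (m + low a b c)) :
    Pot graphK5SubA3 (m + low a b c) := by
  induction hN : Multiset.card m + a + b + c using Nat.strong_induction_on
    generalizing m a b c with
  | _ N ih =>
    replace ih : ∀ (m : Multiset ℕ) (a b c : ℕ), Multiset.card m + a + b + c < N →
        (∀ y ∈ m, 4 ≤ y) → 2 ≤ Multiset.card m → 4 ≤ Multiset.card m + a →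
        5 ≤ Multiset.card m + a + b → Graphic (m + low a b c) →
        Pot graphK5SubA3 (m + low a b c) :=
      fun m a b c hlt h1 h2 h3 h4 h5 => ih _ hlt h1 h2 h3 h4 h5 rfl
    by_cases hN5 : N = 5
    · exact pot_add_low_of_card_eq_five hm h2 h4 h5 (hN.trans hN5) hG
    obtain ⟨d, m, rfl, hd⟩ := Multiset.exists_cons_max (m := m) (by omega)
    rw [Multiset.card_cons] at *
    have hd4 : 4 ≤ d := hm d (Multiset.mem_cons_self _ _)
    replace hm : ∀ y ∈ m, 4 ≤ y := fun y hy => hm y (Multiset.mem_cons_of_mem hy)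
    obtain ⟨d, rfl⟩ := Nat.exists_eq_add_of_le' (show 1 ≤ d by omega)
    -- The cases follow the smallest term: one, then two, then at least four, and finally three.
    rcases c with _ | c
    swap
    · have hG' : Graphic ((d ::ₘ m) + low a b c) := by
        refine hG.layOff_of_eq {d + 1} (m + low a b c) ?_ ?_ (by simp)
        · intro y hy z hz
          rw [Multiset.mem_singleton] at hy
          rcases Multiset.mem_add.1 hz with hz | hz
          · exact hy ▸ hd z hz
          · have := le_three_of_mem_low hz
            omega
        · simp only [low_succ_one, ← Multiset.singleton_add, Multiset.card_singleton]
          abel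
      rcases pot_or_exceptional ih (by
          intro y hy
          rcases Multiset.mem_cons.1 hy with rfl | hy
          · omega
          · exact (by omega : 3 ≤ 4).trans (hm y hy)) (by simp)
        (by rw [Multiset.card_cons]; omega) (by rwa [Multiset.card_cons])
        (by rwa [Multiset.card_cons]) hG' with h | ⟨x, k, hl, h⟩
      · refine h.addVertex_of_eq {d} (m + low a b c) (by simp) ?_
        simp only [low_succ_one, ← Multiset.singleton_add, Multiset.card_singleton,
          Multiset.map_singleton]
        abel
      · rw [← Multiset.singleton_add] at hl
        rcases Multiset.eq_zero_or_singleton_of_add_eq hm hl with ⟨rfl, -⟩ | ⟨rfl, hl'⟩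
        · simp at h2
        · have hk := congrArg Multiset.card hl'
          rw [Multiset.card_singleton, Multiset.card_replicate] at hk
          subst hk
          obtain rfl : d = 3 := by simpa using hl'
          have hx := hm x (by simp)
          have hx' := hd x (by simp)
          obtain rfl : x = 4 := by omega
          rcases h with h | h | h | h | h | h | h | h | h | h <;> try omega
          obtain ⟨-, h, rfl, rfl⟩ := h
          obtain rfl : a = 5 := by omega
          exact pot_4_4_low_5_0_1
    obtain ⟨e, m, rfl, he⟩ := Multiset.exists_cons_max (m := m) (by omega)
    rw [Multiset.card_cons] at *
    have he4 : 4 ≤ e := hm e (Multiset.mem_cons_self _ _)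
    have hed : e ≤ d + 1 := hd e (Multiset.mem_cons_self _ _)
    replace hm : ∀ y ∈ m, 4 ≤ y := fun y hy => hm y (Multiset.mem_cons_of_mem hy)
    clear hd
    obtain ⟨e, rfl⟩ := Nat.exists_eq_add_of_le' (show 1 ≤ e by omega)
    have hl3 : ∀ y ∈ ({d, e} + m : Multiset ℕ), 3 ≤ y := by
      intro y hy
      simp only [Multiset.insert_eq_cons, Multiset.mem_add, Multiset.mem_cons,
        Multiset.mem_singleton] at hy
      rcases hy with (rfl | rfl) | hy
      · omega
      · omega
      · exact (by omega : 3 ≤ 4).trans (hm y hy)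
    have hlc : Multiset.card ({d, e} + m : Multiset ℕ) = Multiset.card m + 1 + 1 := by
      simp [add_comm]
    -- Only one term of an exceptional residual may exceed three; as `e ≤ d`, the second lowered
    -- term must be the three.
    have hpair : ∀ {x k : ℕ}, ({d, e} : Multiset ℕ) = x ::ₘ Multiset.replicate k 3 →
        k = 1 ∧ e = 3 ∧ x = d := by
      intro x k hl
      have hk := congrArg Multiset.card hl
      simp only [Multiset.card_cons, Multiset.card_replicate, Multiset.insert_eq_cons,
        Multiset.card_singleton] at hk
      obtain rfl : k = 1 := by omega
      have h1 : d ∈ x ::ₘ Multiset.replicate 1 3 := hl ▸ by simp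
      have h3 : e ∈ x ::ₘ Multiset.replicate 1 3 := hl ▸ by simp
      have h5 : x ∈ ({d, e} : Multiset ℕ) := hl ▸ by simp
      simp only [Multiset.insert_eq_cons, Multiset.mem_cons, Multiset.replicate_one,
        Multiset.mem_singleton] at h1 h3 h5
      have h6 : (3 : ℕ) ∈ ({d, e} : Multiset ℕ) := hl ▸ by simp
      simp only [Multiset.insert_eq_cons, Multiset.mem_cons, Multiset.mem_singleton] at h6
      omega
    rcases b with _ | b
    swap
    · have hG' : Graphic (({d, e} + m) + low a b 0) := by
        refine hG.layOff_of_eq {d + 1, e + 1} (m + low a b 0) ?_ ?_ ?_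
        · intro y hy z hz
          simp only [Multiset.insert_eq_cons, Multiset.mem_cons, Multiset.mem_singleton] at hy
          rcases Multiset.mem_add.1 hz with hz | hz
          · have := he z hz
            omega
          · have := le_three_of_mem_low hz
            omega
        · simp only [low_succ_two, ← Multiset.singleton_add, Multiset.insert_eq_cons,
            Multiset.card_add, Multiset.card_singleton]
          abel
        · simp
      rcases pot_or_exceptional ih hl3 (by omega) (by omega) (by omega) (by omega) hG' with
        h | ⟨x, k, hl, h⟩
      · refine h.addVertex_of_eq {d, e} (m + low a b 0) (add_assoc _ _ _) ?_
        simp only [low_succ_two, ← Multiset.singleton_add, Multiset.insert_eq_cons,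
          Multiset.map_add, Multiset.map_singleton, Multiset.card_add, Multiset.card_singleton]
        abel
      · rcases Multiset.eq_zero_or_singleton_of_add_eq hm hl with ⟨rfl, hl'⟩ | ⟨rfl, hl'⟩
        · obtain ⟨rfl, rfl, rfl⟩ := hpair hl'
          rcases h with h | h | h | h | h | h | h | h | h | h <;> try omega
          · obtain ⟨rfl, ha, -, hb⟩ := h
            obtain rfl : a = 2 := by omega
            obtain ⟨m, rfl⟩ : ∃ m, b = 2 * m := ⟨b / 2, by omega⟩
            rw [show 1 + 2 + 2 * m + 0 + 1 = 2 * m + 4 by omega]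
            exact pot_cons_four_low m
          all_goals
            obtain ⟨hx, ha, hb⟩ := h
          · obtain rfl : a = 4 := by omega
            subst hb hx
            exact pot_6_4_low_4_1_0
          · obtain rfl : a = 5 := by omega
            subst hb hx
            exact pot_7_4_low_5_1_0
          all_goals
            obtain ⟨rfl, -⟩ := hb
            subst hx
          · obtain rfl : a = 2 := by omega
            exact pot_4_4_low_2_3_0
          · obtain rfl : a = 4 := by omega
            exact pot_4_4_low_4_1_0
          · obtain rfl : a = 2 := by omega
            exact pot_4_4_low_2_4_0
          · obtain rfl : a = 4 := by omega
            exact pot_4_4_low_4_2_0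
          · obtain rfl : a = 5 := by omega
            exact pot_5_4_low_5_1_0
          · obtain rfl : a = 6 := by omega
            exact pot_4_4_low_6_1_0
        · have hk := congrArg Multiset.card hl'
          rw [Multiset.card_replicate] at hk
          obtain rfl : 2 = k := hk
          have h1 := Multiset.eq_of_mem_replicate (hl' ▸ (by simp : d ∈ ({d, e} : Multiset ℕ)))
          have h3 := Multiset.eq_of_mem_replicate (hl' ▸ (by simp : e ∈ ({d, e} : Multiset ℕ)))
          subst h1 h3
          have hx := hm x (by simp)
          have hx' := he x (by simp)
          obtain rfl : x = 4 := by omega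
          rcases h with h | h | h | h | h | h | h | h | h | h <;> try omega
          obtain ⟨-, h, rfl, -⟩ := h
          obtain rfl : a = 4 := by omega
          exact pot_4_4_4_low_4_1_0
    rcases a with _ | a
    -- All terms are at least four here, so the minimum `f` is laid off from the `f` largest of the
    -- others.
    · obtain ⟨f, s, hs, hf⟩ := Multiset.exists_cons_min (m := (d + 1) ::ₘ (e + 1) ::ₘ m) (by simp)
      have hall : ∀ y ∈ f ::ₘ s, 4 ≤ y := by
        rw [← hs]
        intro y hy
        simp only [Multiset.mem_cons] at hy
        rcases hy with rfl | rfl | hy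
        · exact hd4
        · exact he4
        · exact hm y hy
      have hcs := congrArg Multiset.card hs
      simp only [Multiset.card_cons] at hcs
      have h0 : low 0 0 0 = 0 := rfl
      rw [hs, h0, add_zero] at hG ⊢
      have hf4 : 4 ≤ f := hall f (by simp)
      have hlt := hG.lt_card (Multiset.mem_cons_self f s)
      rw [Multiset.card_cons] at hlt
      obtain ⟨t, u, rfl, ht, htu⟩ := Multiset.exists_add_top s (show f ≤ Multiset.card s by omega)
      have hG' : Graphic ((t.map (· - 1) + u) + low 0 0 0) :=
        hG.layOff_of_eq t u htu (by rw [ht]) (by rw [h0, add_zero])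
      have ht4 : ∀ y ∈ t, 4 ≤ y := fun y hy => hall y (by simp [hy])
      have hu4 : ∀ y ∈ u, 4 ≤ y := fun y hy => hall y (by simp [hy])
      rw [Multiset.card_add] at *
      rcases pot_or_exceptional ih (l := t.map (· - 1) + u) (a := 0) (b := 0) (c := 0) (by
          intro y hy
          rcases Multiset.mem_add.1 hy with hy | hy
          · obtain ⟨z, hz, rfl⟩ := Multiset.mem_map.1 hy
            have := ht4 z hz
            omega
          · exact (by omega : 3 ≤ 4).trans (hu4 y hy))
          (by simp only [Multiset.card_add, Multiset.card_map]; omega)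
          (by simp only [Multiset.card_add, Multiset.card_map]; omega)
          (by simp only [Multiset.card_add, Multiset.card_map]; omega)
          (by simp only [Multiset.card_add, Multiset.card_map]; omega) hG' with
        h | ⟨x, k, hl, h⟩
      · rw [h0, add_zero] at h
        refine h.addVertex_of_eq _ _ rfl ?_
        rw [Multiset.card_map, ht, Multiset.map_map]
        congr 2
        refine (Multiset.map_id t).symm.trans (Multiset.map_congr rfl fun y hy => ?_)
        have := ht4 y hy
        simp only [id, Function.comp_apply]
        omega
      -- A three in the residual comes from a four, so `f = 4` and only four terms were lowered.
      -- Then `k ≤ 4`, whereas every exception without twos has at least five threes after its head.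
      · exfalso
        have hc := congrArg Multiset.card hl
        rw [Multiset.card_add, Multiset.card_map, Multiset.card_cons,
          Multiset.card_replicate] at hc
        obtain ⟨hk, h3⟩ : k ≤ Multiset.card t ∧ 3 ∈ t.map (· - 1) := by
          rcases Multiset.eq_zero_or_singleton_of_add_eq hu4 hl with ⟨rfl, hl'⟩ | ⟨rfl, hl'⟩
          · rw [Multiset.card_zero] at hc
            refine ⟨by omega, ?_⟩
            rw [hl']
            exact Multiset.mem_cons_of_mem (Multiset.mem_replicate.2 ⟨by omega, rfl⟩)
          · rw [Multiset.card_singleton] at hc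
            refine ⟨by omega, ?_⟩
            rw [hl']
            exact Multiset.mem_replicate.2 ⟨by omega, rfl⟩
        obtain ⟨z, hz, hz3⟩ := Multiset.mem_map.1 h3
        have h7 := hf z (by simp [hz])
        have h8 := ht4 z hz
        rcases h with h | h | h | h | h | h | h | h | h | h <;> omega
    rcases Nat.eq_zero_or_pos (Multiset.card m) with hm0 | hm0
    · obtain rfl := Multiset.card_eq_zero.1 hm0
      rw [Multiset.card_zero] at *
      obtain ⟨a, rfl⟩ := Nat.exists_eq_add_of_le' (show 2 ≤ a by omega)
      have hG' : Graphic (({d, e} + 0) + low (a + 1) 1 0) := by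
        refine hG.layOff_of_eq {d + 1, e + 1, 3} (low (a + 1) 0 0) ?_ ?_ ?_
        · intro y hy z hz
          simp only [Multiset.insert_eq_cons, Multiset.mem_cons, Multiset.mem_singleton] at hy
          have := le_three_of_mem_low hz
          omega
        · simp only [low_succ_three, ← Multiset.singleton_add, Multiset.insert_eq_cons,
            Multiset.card_add, Multiset.card_singleton, add_zero]
          abel
        · simp only [low_succ_two, ← Multiset.singleton_add, Multiset.insert_eq_cons, add_zero,
            Multiset.map_add, Multiset.map_singleton, Nat.add_sub_cancel, Nat.reduceSub]
          abel
      rcases pot_or_exceptional ih hl3 (by omega) (by omega) (by omega) (by omega) hG' with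
        h | ⟨x, k, hl, h⟩
      · refine h.addVertex_of_eq {d, e, 2} (low (a + 1) 0 0) ?_ ?_
        · simp only [low_succ_two, ← Multiset.singleton_add, Multiset.insert_eq_cons, add_zero]
          abel
        · simp only [low_succ_three, ← Multiset.singleton_add, Multiset.insert_eq_cons, add_zero,
            Multiset.map_add, Multiset.map_singleton, Multiset.card_add, Multiset.card_singleton]
          abel
      · rw [add_zero] at hl
        obtain ⟨rfl, rfl, rfl⟩ := hpair hl
        rcases h with h | h | h | h | h | h | h | h | h | h <;> try omega
        obtain ⟨rfl, ha, -⟩ := h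
        obtain rfl : a = 3 := by omega
        exact pot_4_4_low_6_0_0
    obtain ⟨f, m, rfl, hf⟩ := Multiset.exists_cons_max hm0
    rw [Multiset.card_cons] at *
    have hf4 : 4 ≤ f := hm f (Multiset.mem_cons_self _ _)
    have hfe : f ≤ e + 1 := he f (Multiset.mem_cons_self _ _)
    replace hm : ∀ y ∈ m, 4 ≤ y := fun y hy => hm y (Multiset.mem_cons_of_mem hy)
    clear he hl3 hlc
    obtain ⟨f, rfl⟩ := Nat.exists_eq_add_of_le' (show 1 ≤ f by omega)
    have hG' : Graphic (({d, e, f} + m) + low a 0 0) := by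
      refine hG.layOff_of_eq {d + 1, e + 1, f + 1} (m + low a 0 0) ?_ ?_ ?_
      · intro y hy z hz
        simp only [Multiset.insert_eq_cons, Multiset.mem_cons, Multiset.mem_singleton] at hy
        rcases Multiset.mem_add.1 hz with hz | hz
        · have := hf z hz
          omega
        · have := le_three_of_mem_low hz
          omega
      · simp only [low_succ_three, ← Multiset.singleton_add, Multiset.insert_eq_cons,
          Multiset.card_add, Multiset.card_singleton]
        abel
      · simp
    rcases pot_or_exceptional ih (l := {d, e, f} + m) (by
        intro y hy
        simp only [Multiset.insert_eq_cons, Multiset.mem_add, Multiset.mem_cons,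
          Multiset.mem_singleton] at hy
        rcases hy with (rfl | rfl | rfl) | hy
        · omega
        · omega
        · omega
        · exact (by omega : 3 ≤ 4).trans (hm y hy)) (by simp)
        (by simp only [Multiset.insert_eq_cons, Multiset.card_add, Multiset.card_cons,
              Multiset.card_singleton]; omega)
        (by simp only [Multiset.insert_eq_cons, Multiset.card_add, Multiset.card_cons,
              Multiset.card_singleton]; omega)
        (by simp only [Multiset.insert_eq_cons, Multiset.card_add, Multiset.card_cons,
              Multiset.card_singleton]; omega) hG' with h | ⟨x, k, hl, h⟩
    · refine h.addVertex_of_eq {d, e, f} (m + low a 0 0) (add_assoc _ _ _) ?_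
      simp only [low_succ_three, ← Multiset.singleton_add, Multiset.insert_eq_cons,
        Multiset.map_add, Multiset.map_singleton, Multiset.card_add, Multiset.card_singleton]
      abel
    · rcases Multiset.eq_zero_or_singleton_of_add_eq hm hl with ⟨rfl, hl'⟩ | ⟨rfl, hl'⟩
      · have hk := congrArg Multiset.card hl'
        simp only [Multiset.card_cons, Multiset.card_replicate, Multiset.insert_eq_cons,
          Multiset.card_singleton] at hk
        obtain rfl : k = 2 := by omega
        obtain ⟨rfl, rfl, rfl⟩ : e = 3 ∧ f = 3 ∧ x = d := by
          -- Since `f ≤ e ≤ d`, any other value of `f` would leave three terms above three.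
          have h1 : f = 3 := by
            by_contra hne
            rcases Multiset.eq_zero_or_singleton_of_add_eq (l := 0) (m := {d, e, f}) (by
              intro y hy
              simp only [Multiset.insert_eq_cons, Multiset.mem_cons,
                Multiset.mem_singleton] at hy
              omega) (by rw [zero_add]; exact hl') with ⟨h, -⟩ | ⟨-, h⟩ <;>
            · have := congrArg Multiset.card h
              simp at this
          subst h1
          have h7 : ({d, e} : Multiset ℕ) = x ::ₘ Multiset.replicate 1 3 := by
            have h8 : 3 ::ₘ ({d, e} : Multiset ℕ) = 3 ::ₘ x ::ₘ Multiset.replicate 1 3 := by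
              rw [Multiset.cons_swap 3 x, ← Multiset.replicate_succ, ← hl']
              simp only [Multiset.insert_eq_cons, ← Multiset.singleton_add]
              abel
            exact (Multiset.cons_inj_right 3).1 h8
          obtain ⟨-, h9, h10⟩ := hpair h7
          exact ⟨h9, rfl, h10⟩
        rcases h with h | h | h | h | h | h | h | h | h | h <;> try omega
        all_goals obtain ⟨hx, ha, -⟩ := h
        · obtain rfl : a = 3 := by omega
          subst hx
          exact pot_6_4_4_low_4_0_0
        · obtain rfl : a = 4 := by omega
          subst hx
          exact pot_7_4_4_low_5_0_0
        · obtain rfl : a = 3 := by omega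
          subst hx
          exact pot_4_4_4_low_4_0_0
        · obtain rfl : a = 4 := by omega
          subst hx
          exact pot_5_4_4_low_5_0_0
        · obtain rfl : a = 5 := by omega
          subst hx
          exact pot_4_4_4_low_6_0_0
      · have hk := congrArg Multiset.card hl'
        rw [Multiset.card_replicate] at hk
        obtain rfl : 3 = k := hk
        have h1 := Multiset.eq_of_mem_replicate (hl' ▸ (by simp : d ∈ ({d, e, f} : Multiset ℕ)))
        have h3 := Multiset.eq_of_mem_replicate (hl' ▸ (by simp : e ∈ ({d, e, f} : Multiset ℕ)))
        have h7 := Multiset.eq_of_mem_replicate (hl' ▸ (by simp : f ∈ ({d, e, f} : Multiset ℕ)))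
        subst h1 h3 h7
        have hx := hm x (by simp)
        have hx' := hf x (by simp)
        obtain rfl : x = 4 := by omega
        rcases h with h | h | h | h | h | h | h | h | h | h <;> try omega
        obtain ⟨-, h, -⟩ := h
        obtain rfl : a = 3 := by omega
        exact pot_4_4_4_4_low_4_0_0

/-! ### Necessity: a dominating vertex -/

theorem SimpleGraph.ncard_neighborSet {V : Type} (G : SimpleGraph V) (v : V)
    [Fintype (G.neighborSet v)] : (G.neighborSet v).ncard = G.degree v := by
  rw [← Nat.card_coe_set_eq, Nat.card_eq_fintype_card, G.card_neighborSet_eq_degree]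

/-- In a graph with a dominating vertex `x` and all other degrees at most three, a four-cycle
avoiding `x` uses up the degrees of its vertices. -/
theorem card_degree_three_of_cycle {V : Type} [Fintype V] {G : SimpleGraph V} {d : V → ℕ}
    (hd : ∀ v, (G.neighborSet v).ncard = d v) {x : V} (hx : ∀ v, v ≠ x → G.Adj v x)
    (hx3 : d x ≠ 3) (hle : ∀ v, v ≠ x → d v ≤ 3) {p q r s : V} (hpx : p ≠ x) (hqx : q ≠ x)
    (hrx : r ≠ x) (hsx : s ≠ x) (hpr : p ≠ r) (hqs : q ≠ s) (hpq : G.Adj p q) (hqr : G.Adj q r)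
    (hrs : G.Adj r s) (hsp : G.Adj s p) :
    4 ≤ {v | d v = 3}.ncard ∧
      ((∀ v, d v ≠ 2) → {v | d v = 3}.ncard = 4 ∨ 7 ≤ {v | d v = 3}.ncard) := by
  classical
  -- Two neighbours besides `x` exhaust the degree bound three, so the neighbourhood is known
  -- exactly.
  have key : ∀ v y z, v ≠ x → y ≠ x → z ≠ x → y ≠ z → G.Adj v y → G.Adj v z →
      d v = 3 ∧ G.neighborSet v = {x, y, z} := by
    intro v y z hv hy hz hyz h1 h2
    have hsub : ({x, y, z} : Set V) ⊆ G.neighborSet v := by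
      rintro w (rfl | rfl | rfl)
      · exact hx v hv
      · exact h1
      · exact h2
    have hc : ({x, y, z} : Set V).ncard = 3 :=
      Set.ncard_eq_three.2 ⟨x, y, z, hy.symm, hz.symm, hyz, rfl⟩
    have hle' : (G.neighborSet v).ncard ≤ ({x, y, z} : Set V).ncard := by
      rw [hd, hc]
      exact hle v hv
    have heq := Set.eq_of_subset_of_ncard_le hsub hle' (Set.toFinite _)
    exact ⟨by rw [← hd, ← heq, hc], heq.symm⟩
  obtain ⟨hp3, hpN⟩ := key p q s hpx hqx hsx hqs hpq hsp.symm
  obtain ⟨hq3, hqN⟩ := key q p r hqx hpx hrx hpr hpq.symm hqr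
  obtain ⟨hr3, hrN⟩ := key r q s hrx hqx hsx hqs hqr.symm hrs
  obtain ⟨hs3, hsN⟩ := key s p r hsx hpx hrx hpr hsp hrs.symm
  have hC : ({p, q, r, s} : Finset V).card = 4 :=
    Finset.card_eq_four.2 ⟨p, q, r, s, hpq.ne, hpr, hsp.ne', hqr.ne, hqs, hrs.ne, rfl⟩
  have hsub : (({p, q, r, s} : Finset V) : Set V) ⊆ {v | d v = 3} := by
    intro v hv
    simp only [Finset.coe_insert, Finset.coe_singleton, Set.mem_insert_iff,
      Set.mem_singleton_iff] at hv
    rcases hv with rfl | rfl | rfl | rfl <;> assumption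
  have hclosed : ∀ v ∈ ({p, q, r, s} : Finset V), ∀ w, G.Adj v w →
      w = x ∨ w ∈ ({p, q, r, s} : Finset V) := by
    intro v hv w hw
    replace hw : w ∈ G.neighborSet v := hw
    simp only [Finset.mem_insert, Finset.mem_singleton] at hv ⊢
    rcases hv with rfl | rfl | rfl | rfl
    · rw [hpN, Set.mem_insert_iff, Set.mem_insert_iff, Set.mem_singleton_iff] at hw; tauto
    · rw [hqN, Set.mem_insert_iff, Set.mem_insert_iff, Set.mem_singleton_iff] at hw; tauto
    · rw [hrN, Set.mem_insert_iff, Set.mem_insert_iff, Set.mem_singleton_iff] at hw; tauto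
    · rw [hsN, Set.mem_insert_iff, Set.mem_insert_iff, Set.mem_singleton_iff] at hw; tauto
  have h4 := Set.ncard_le_ncard hsub (Set.toFinite _)
  rw [Set.ncard_coe_finset, hC] at h4
  refine ⟨h4, fun hno => ?_⟩
  by_cases hall : {v | d v = 3} ⊆ (({p, q, r, s} : Finset V) : Set V)
  · left
    rw [Set.Subset.antisymm hall hsub, Set.ncard_coe_finset, hC]
  · right
    -- A further vertex of degree three has two neighbours besides `x`. They lie off the closed
    -- cycle and have degree at least two, hence three when twos are absent; so four threes jump to
    -- at least seven.
    obtain ⟨u, hu3, huC⟩ := Set.not_subset.1 hall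
    replace huC : u ∉ ({p, q, r, s} : Finset V) := huC
    have hu3 : d u = 3 := hu3
    have hux : u ≠ x := by rintro rfl; exact hx3 hu3
    have h2 : (G.neighborSet u \ {x}).ncard = 2 := by
      rw [Set.ncard_sdiff_singleton_of_mem (show x ∈ G.neighborSet u from hx u hux), hd, hu3]
    obtain ⟨y, z, hyz, hN⟩ := Set.ncard_eq_two.1 h2
    have hnb : ∀ y, y ∈ G.neighborSet u \ {x} → d y = 3 ∧ y ∉ ({p, q, r, s} : Finset V) ∧ u ≠ y := by
      intro y hy
      have hadj : G.Adj u y := hy.1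
      have hyx : y ≠ x := hy.2
      refine ⟨?_, fun h => ?_, hadj.ne⟩
      · have h2 : ({x, u} : Set V) ⊆ G.neighborSet y := by
          rintro w (rfl | rfl)
          · exact hx y hyx
          · exact hadj.symm
        have := Set.ncard_le_ncard h2 (Set.toFinite _)
        rw [Set.ncard_pair hux.symm, hd] at this
        have h3 := hle y hyx
        have h4 := hno y
        omega
      · rcases hclosed y h u hadj.symm with h | h
        · exact hux h
        · exact huC h
    obtain ⟨hy3, hyC, huy⟩ := hnb y (hN ▸ by simp)
    obtain ⟨hz3, hzC, huz⟩ := hnb z (hN ▸ by simp)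
    have hT : ((insert u (insert y (insert z ({p, q, r, s} : Finset V))) : Finset V) : Set V) ⊆
        {v | d v = 3} := by
      intro v hv
      rw [Finset.mem_coe, Finset.mem_insert, Finset.mem_insert, Finset.mem_insert] at hv
      rcases hv with rfl | rfl | rfl | hv
      · exact hu3
      · exact hy3
      · exact hz3
      · exact hsub hv
    have h7 := Set.ncard_le_ncard hT (Set.toFinite _)
    rwa [Set.ncard_coe_finset, Finset.card_insert_of_notMem, Finset.card_insert_of_notMem,
      Finset.card_insert_of_notMem hzC, hC] at h7
    · rw [Finset.mem_insert]; exact not_or.2 ⟨hyz, hyC⟩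
    · rw [Finset.mem_insert, Finset.mem_insert]; exact not_or.2 ⟨huy, not_or.2 ⟨huz, huC⟩⟩

/-- A vertex other than `x` has at most two neighbours besides `x`. So each degree-three vertex of
the copy is `x` or has `x` as a neighbour within the copy, which forces `x` to be the image of `inl
0` or `inl 2`. Deleting either one leaves a four-cycle through `inl 1`, `inr 0`, `inr 1` and the
other. -/
theorem card_degree_three_of_isContained {V : Type} [Fintype V] {G : SimpleGraph V} {d : V → ℕ}
    (hd : ∀ v, (G.neighborSet v).ncard = d v) {x : V} (hx : d x + 1 = Fintype.card V)
    (hx3 : d x ≠ 3) (hle : ∀ v, v ≠ x → d v ≤ 3) (hH : graphK5SubA3.IsContained G) :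
    4 ≤ {v | d v = 3}.ncard ∧
      ((∀ v, d v ≠ 2) → {v | d v = 3}.ncard = 4 ∨ 7 ≤ {v | d v = 3}.ncard) := by
  classical
  have hxadj : ∀ v, v ≠ x → G.Adj v x := by
    have hsub : G.neighborSet x ⊆ {x}ᶜ := fun v hv => (G.ne_of_adj hv).symm
    have hcard : ({x}ᶜ : Set V).ncard ≤ (G.neighborSet x).ncard := by
      rw [hd, Set.ncard_compl, Set.ncard_singleton, Nat.card_eq_fintype_card]
      omega
    have := Set.eq_of_subset_of_ncard_le hsub hcard (Set.toFinite _)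
    intro v hv
    exact G.symm.symm _ _ (show v ∈ G.neighborSet x from this ▸ hv)
  obtain ⟨f⟩ := hH
  have hadj : ∀ p q, graphK5SubA3.Adj p q → G.Adj (f p) (f q) := fun p q h => f.toHom.map_adj h
  have hinj : Function.Injective f := f.injective
  have hthree : ∀ p q r s, f p ≠ x → q ≠ r → q ≠ s → r ≠ s → graphK5SubA3.Adj p q →
      graphK5SubA3.Adj p r → graphK5SubA3.Adj p s → f q = x ∨ f r = x ∨ f s = x := by
    intro p q r s hp hqr hqs hrs h1 h2 h3
    by_contra! hcon
    have hsub : (({x, f q, f r, f s} : Finset V) : Set V) ⊆ G.neighborSet (f p) := by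
      intro w hw
      simp only [Finset.coe_insert, Finset.coe_singleton, Set.mem_insert_iff,
        Set.mem_singleton_iff] at hw
      rcases hw with rfl | rfl | rfl | rfl
      · exact hxadj _ hp
      · exact hadj _ _ h1
      · exact hadj _ _ h2
      · exact hadj _ _ h3
    have hc := Set.ncard_le_ncard hsub (Set.toFinite _)
    rw [Set.ncard_coe_finset, Finset.card_eq_four.2 ⟨x, f q, f r, f s, hcon.1.symm,
      hcon.2.1.symm, hcon.2.2.symm, hinj.ne hqr, hinj.ne hqs, hinj.ne hrs, rfl⟩, hd] at hc
    have := hle _ hp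
    omega
  have hx02 : f (.inl 0) = x ∨ f (.inl 2) = x := by
    by_contra! hcon
    have h1 : f (.inl 1) = x := by
      by_contra h1
      by_cases h : f (.inr 0) = x
      · rcases hthree (.inr 1) (.inl 0) (.inl 1) (.inl 2) (h ▸ hinj.ne (by decide)) (by decide)
          (by decide) (by decide) (by decide) (by decide) (by decide) with h | h | h
        · exact hcon.1 h
        · exact h1 h
        · exact hcon.2 h
      · rcases hthree (.inr 0) (.inl 0) (.inl 1) (.inl 2) h (by decide)
          (by decide) (by decide) (by decide) (by decide) (by decide) with h | h | h
        · exact hcon.1 h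
        · exact h1 h
        · exact hcon.2 h
    rcases hthree (.inl 0) (.inl 2) (.inr 0) (.inr 1) hcon.1 (by decide)
      (by decide) (by decide) (by decide) (by decide) (by decide) with h | h | h
    · exact hcon.2 h
    · exact absurd (hinj (h.trans h1.symm)) (by decide)
    · exact absurd (hinj (h.trans h1.symm)) (by decide)
  have main : ∀ p, f p = x → ∀ q, q ≠ p → q ≠ .inl 1 → p ≠ .inl 1 → p ≠ .inr 0 → p ≠ .inr 1 →
      q ≠ .inr 0 → q ≠ .inr 1 → 4 ≤ {v | d v = 3}.ncard ∧
      ((∀ v, d v ≠ 2) → {v | d v = 3}.ncard = 4 ∨ 7 ≤ {v | d v = 3}.ncard) := by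
    intro p hp q hqp hq1 hp1 hp0 hp2 hq0 hq2
    have hne : ∀ r, r ≠ p → f r ≠ x := fun r hr h => hr (hinj (h.trans hp.symm))
    have hq : q = .inl 0 ∨ q = .inl 2 := by
      revert hq1 hq0 hq2; clear hqp; revert q; decide
    have hqa : graphK5SubA3.Adj q (.inr 0) ∧ graphK5SubA3.Adj (.inr 1) q := by
      rcases hq with rfl | rfl <;> decide
    exact card_degree_three_of_cycle hd hxadj hx3 hle (hne q hqp) (hne _ hp0.symm)
      (hne _ hp1.symm) (hne _ hp2.symm) (hinj.ne hq1) (hinj.ne (show Sum.inr 0 ≠ Sum.inr 1 by decide))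
      (hadj _ _ hqa.1) (hadj (.inr 0) (.inl 1) (by decide)) (hadj (.inl 1) (.inr 1) (by decide))
      (hadj _ _ hqa.2)
  rcases hx02 with h | h
  · exact main _ h (.inl 2) (by decide) (by decide) (by decide) (by decide) (by decide)
      (by decide) (by decide)
  · exact main _ h (.inl 0) (by decide) (by decide) (by decide) (by decide) (by decide)
      (by decide) (by decide)

/-! ### Necessity: an edge count around a copy -/

/-- Counting the edges inside, outside and leaving a copy of `K₅ - A₃`. -/
theorem exists_five_of_isContained {V : Type} [Fintype V] [DecidableEq V] {G : SimpleGraph V}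
    {d : V → ℕ} (hd : ∀ v, (G.neighborSet v).ncard = d v) (hH : graphK5SubA3.IsContained G) :
    ∃ S ∈ Finset.powersetCard 5 (Finset.univ : Finset V), (∀ v ∈ S, 2 ≤ d v) ∧
      4 ≤ (S.filter (3 ≤ d ·)).card ∧
      ∑ v ∈ Sᶜ, (d v - (Sᶜ.card - 1)) + 14 ≤ ∑ v ∈ S, d v := by
  classical
  obtain ⟨f⟩ := hH
  let e : Fin 3 ⊕ Fin 2 ↪ V := ⟨f, f.injective⟩
  have hadj : ∀ p q, graphK5SubA3.Adj p q → G.Adj (e p) (e q) := fun p q h => f.toHom.map_adj h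
  let S := Finset.univ.map e
  have hsplit : ∀ v, d v = (G.neighborFinset v ∩ S).card + (G.neighborFinset v ∩ Sᶜ).card := by
    intro v
    rw [← hd, G.ncard_neighborSet, ← G.card_neighborFinset_eq_degree,
      ← Finset.card_inter_add_card_sdiff _ S, Finset.sdiff_eq_inter_compl]
  have hin : ∀ p, graphK5SubA3.degree p ≤ (G.neighborFinset (e p) ∩ S).card := by
    intro p
    rw [← graphK5SubA3.card_neighborFinset_eq_degree, ← Finset.card_map e]
    refine Finset.card_le_card fun v hv => ?_
    obtain ⟨q, hq, rfl⟩ := Finset.mem_map.1 hv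
    rw [Finset.mem_inter, SimpleGraph.mem_neighborFinset]
    rw [SimpleGraph.mem_neighborFinset] at hq
    exact ⟨hadj p q hq, Finset.mem_map_of_mem _ (Finset.mem_univ _)⟩
  have hdeg : ∀ p, graphK5SubA3.degree p ≤ d (e p) := fun p =>
    (hin p).trans ((Nat.le_add_right _ _).trans (hsplit _).ge)
  refine ⟨S, Finset.mem_powersetCard.2 ⟨Finset.subset_univ _, by simp [S]⟩, ?_, ?_, ?_⟩
  · intro v hv
    obtain ⟨p, -, rfl⟩ := Finset.mem_map.1 hv
    refine le_trans ?_ (hdeg p)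
    exact (show ∀ p, 2 ≤ graphK5SubA3.degree p by decide) p
  · have h4 : (Finset.univ.filter (fun p => 3 ≤ graphK5SubA3.degree p)).card = 4 := by decide
    rw [← h4, ← Finset.card_map e]
    refine Finset.card_le_card fun v hv => ?_
    obtain ⟨p, hp, rfl⟩ := Finset.mem_map.1 hv
    exact Finset.mem_filter.2 ⟨Finset.mem_map_of_mem _ (Finset.mem_univ _),
      (Finset.mem_filter.1 hp).2.trans (hdeg p)⟩
  -- Fourteen is twice the number of edges of `K₅ - A₃`; the remaining degree sum of `S` counts the
  -- edges leaving it.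
  · have h14 : 14 ≤ ∑ v ∈ S, (G.neighborFinset v ∩ S).card := by
      rw [Finset.sum_map]
      calc 14 = ∑ p, graphK5SubA3.degree p := by decide
        _ ≤ _ := Finset.sum_le_sum fun p _ => hin p
    have hcross : ∑ v ∈ S, (G.neighborFinset v ∩ Sᶜ).card =
        ∑ v ∈ Sᶜ, (G.neighborFinset v ∩ S).card := by
      have := Finset.sum_card_bipartiteAbove_eq_sum_card_bipartiteBelow (s := S) (t := Sᶜ) G.Adj
      convert this using 2 with v hv v hv
      · congr 1
        ext w
        simp [Finset.bipartiteAbove, and_comm]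
      · congr 1
        ext w
        simp [Finset.bipartiteBelow, and_comm, G.adj_comm]
    -- An outside vertex has at most `Sᶜ.card - 1` neighbours outside, so its surplus must go into
    -- `S`.
    have hout : ∀ v ∈ Sᶜ, d v - (Sᶜ.card - 1) ≤ (G.neighborFinset v ∩ S).card := by
      intro v hv
      have : (G.neighborFinset v ∩ Sᶜ).card ≤ Sᶜ.card - 1 := by
        rw [← Finset.card_erase_of_mem hv]
        refine Finset.card_le_card fun w hw => ?_
        rw [Finset.mem_inter, SimpleGraph.mem_neighborFinset] at hw
        exact Finset.mem_erase.2 ⟨hw.1.ne', hw.2⟩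
      rw [hsplit v]
      omega
    have h1 := Finset.sum_le_sum hout
    have h2 : ∑ v ∈ S, d v = ∑ v ∈ S, (G.neighborFinset v ∩ S).card +
        ∑ v ∈ S, (G.neighborFinset v ∩ Sᶜ).card := by
      rw [← Finset.sum_add_distrib]
      exact Finset.sum_congr rfl fun v _ => hsplit v
    omega

/-! ### From sorted sequences to multisets and back -/

theorem Multiset.eq_filter_add_low {s : Multiset ℕ} (hs : ∀ y ∈ s, 0 < y) :
    ∃ m a b c, s = m + low a b c ∧ ∀ y ∈ m, 4 ≤ y := by
  refine ⟨s.filter (4 ≤ ·), s.count 3, s.count 2, s.count 1, ?_,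
    fun y hy => (Multiset.mem_filter.1 hy).2⟩
  ext y
  rw [low, Multiset.count_add, Multiset.count_add, Multiset.count_add, Multiset.count_filter,
    Multiset.count_replicate, Multiset.count_replicate, Multiset.count_replicate]
  obtain rfl | rfl | rfl | rfl | hy : y = 0 ∨ y = 1 ∨ y = 2 ∨ y = 3 ∨ 4 ≤ y := by omega
  · have : (0 : ℕ) ∉ s := fun h => absurd (hs 0 h) (by omega)
    simp [this]
  · simp
  · simp
  · simp
  · rw [if_pos hy, if_neg (by omega), if_neg (by omega), if_neg (by omega)]
    rfl

theorem countP_two_le {m : Multiset ℕ} (a b c : ℕ) (hm : ∀ y ∈ m, 4 ≤ y) :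
    (m + low a b c).countP (2 ≤ ·) = Multiset.card m + a + b := by
  rw [Multiset.countP_add, Multiset.countP_eq_card.2 fun y hy => le_trans (by omega) (hm y hy)]
  simp [low, ← Multiset.coe_replicate, List.countP_replicate, add_assoc]

theorem countP_three_le {m : Multiset ℕ} (a b c : ℕ) (hm : ∀ y ∈ m, 4 ≤ y) :
    (m + low a b c).countP (3 ≤ ·) = Multiset.card m + a := by
  rw [Multiset.countP_add, Multiset.countP_eq_card.2 fun y hy => le_trans (by omega) (hm y hy)]
  simp [low, ← Multiset.coe_replicate, List.countP_replicate]

/-- In a sorted sequence a bound on one term is a bound on how many terms reach a threshold; the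
next lemma is the converse direction. -/
theorem lt_countP_of_antitone {n : ℕ} {π : Fin n → ℕ} (hπ : Antitone π) (i : Fin n) {r : ℕ}
    (hr : r ≤ π i) : i.val < (Finset.univ.val.map π).countP (r ≤ ·) := by
  rw [Multiset.countP_map]
  calc i.val < (Finset.Iic i).card := by simp
    _ ≤ (Finset.univ.filter fun j => r ≤ π j).card :=
      Finset.card_le_card fun j hj => Finset.mem_filter.2
        ⟨Finset.mem_univ _, hr.trans (hπ (Finset.mem_Iic.1 hj))⟩

theorem le_of_le_card_filter {n : ℕ} {π : Fin n → ℕ} (hπ : Antitone π) (i : Fin n) {r : ℕ}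
    {S : Finset (Fin n)} (hS : ∀ j ∈ S, r ≤ π j) (hi : i.val < S.card) : r ≤ π i := by
  by_contra! hcon
  have : S ⊆ Finset.Iio i := fun j hj => by
    rw [Finset.mem_Iio]
    by_contra! hij
    exact absurd ((hS j hj).trans (hπ hij)) (by omega)
  have := Finset.card_le_card this
  rw [Fin.card_Iio] at this
  omega

/-- The non-increasing list of the multiset `(x, 3 ^ a, 2 ^ b, 1 ^ c)`. -/
theorem ofFn_eq_of_map_eq {n : ℕ} {π : Fin n → ℕ} (hπ : Antitone π) {x a b c : ℕ} (hx : 3 ≤ x)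
    (h : Finset.univ.val.map π = x ::ₘ low a b c) :
    List.ofFn π = x :: (rep 3 a ++ rep 2 b ++ rep 1 c) := by
  refine List.Perm.eq_of_sortedGE ?_ ?_ ?_
  · exact List.sortedGE_ofFn_iff.2 hπ
  · rw [List.sortedGE_iff_pairwise]
    simp only [List.pairwise_cons, List.pairwise_append, List.mem_append, List.mem_replicate,
      List.pairwise_replicate]
    refine ⟨by omega, ⟨by omega, by omega, by omega⟩, by omega, by omega⟩
  · rw [← Multiset.coe_eq_coe]
    refine Eq.trans ?_ h
    simp

theorem IsPotentiallyGraphic.pot {U : Type} {K : SimpleGraph U} {n : ℕ} {π : Fin n → ℕ}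
    (h : Pot K (Finset.univ.val.map π)) (hπ : Antitone π) : IsPotentiallyGraphic K π :=
  ⟨hπ, h.realize π rfl⟩

/-- The number of terms above three decides between `pot_add_low` and `pot_cons_low`; only the
latter consults `hE`, through the unique sorted list. -/
theorem isPotentiallyGraphic_of_not_exceptional {n : ℕ} {π : Fin n → ℕ} (hπ : IsGraphic π)
    (hpos : ∀ i, 0 < π i) {i j : Fin n} (hi : i.val = 3) (hj : j.val = 4) (h3 : 3 ≤ π i)
    (h2 : 2 ≤ π j)
    (hE : ∀ x a b c, List.ofFn π = x :: (rep 3 a ++ rep 2 b ++ rep 1 c) →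
      ¬ Exceptional x a b c) : IsPotentiallyGraphic graphK5SubA3 π := by
  obtain ⟨hanti, G, hG⟩ := hπ
  refine IsPotentiallyGraphic.pot ?_ hanti
  have hgr : Graphic (Finset.univ.val.map π) := ⟨Fin n, inferInstance, π, G, rfl, hG, .of_isEmpty⟩
  have h4 := lt_countP_of_antitone hanti _ h3
  have h5 := lt_countP_of_antitone hanti _ h2
  obtain ⟨m, a, b, c, hs, hm⟩ := Multiset.eq_filter_add_low (s := Finset.univ.val.map π) (by
    intro y hy
    obtain ⟨i, -, rfl⟩ := Multiset.mem_map.1 hy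
    exact hpos i)
  rw [hs] at hgr h4 h5 ⊢
  rw [countP_three_le a b c hm] at h4
  rw [countP_two_le a b c hm] at h5
  rw [hi] at h4
  rw [hj] at h5
  by_cases hm2 : 2 ≤ Multiset.card m
  · exact pot_add_low hm hm2 h4 h5 hgr
  · obtain ⟨x, a', hx, ha', hab, heq⟩ : ∃ x a', 3 ≤ x ∧ 3 ≤ a' ∧ 4 ≤ a' + b ∧
        m + low a b c = x ::ₘ low a' b c := by
      obtain h0 | h1 : Multiset.card m = 0 ∨ Multiset.card m = 1 := by omega
      · obtain ⟨a, rfl⟩ := Nat.exists_eq_add_of_le' (show 1 ≤ a by omega)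
        refine ⟨3, a, le_rfl, by omega, by omega, ?_⟩
        rw [Multiset.card_eq_zero.1 h0, zero_add, low_succ_three]
      · obtain ⟨y, rfl⟩ := Multiset.card_eq_one.1 h1
        have := hm y (Multiset.mem_singleton_self y)
        rw [Multiset.card_singleton] at h4 h5
        exact ⟨y, a, by omega, by omega, by omega, rfl⟩
    rw [heq] at hgr hs ⊢
    exact pot_cons_low hgr hx ha' hab (hE x a' b c (ofFn_eq_of_map_eq hanti hx hs))

theorem map_univ_eq_of_ofFn_eq {n : ℕ} {π : Fin n → ℕ} {L : List ℕ} (h : List.ofFn π = L) :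
    Finset.univ.val.map π = L := by
  rw [← h]
  simp

/-- Sequences in which a dominating vertex is followed by terms at most three contain four or at
least seven threes when they contain no twos. -/
theorem IsPotentiallyGraphic.count_three {n : ℕ} {π : Fin n → ℕ} (hn : 5 ≤ n)
    (h : IsPotentiallyGraphic graphK5SubA3 π) {L : List ℕ}
    (hL : List.ofFn π = (n - 1) :: L) (hL3 : ∀ y ∈ L, y ≤ 3) :
    4 ≤ L.count 3 ∧ (2 ∉ L → L.count 3 = 4 ∨ 7 ≤ L.count 3) := by
  obtain ⟨-, G, hG, hH⟩ := h
  obtain ⟨n, rfl⟩ := Nat.exists_eq_add_of_le' (show 1 ≤ n by omega)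
  rw [List.ofFn_succ, List.cons.injEq, Nat.add_sub_cancel] at hL
  obtain ⟨h0, rfl⟩ := hL
  have hcount : {v | π v = 3}.ncard = (List.ofFn fun i => π (Fin.succ i)).count 3 := by
    have h1 : (List.ofFn π).count 3 = {v | π v = 3}.ncard := by
      rw [← Multiset.coe_count, ← map_univ_eq_of_ofFn_eq rfl, Multiset.count_map,
        Set.ncard_eq_toFinset_card']
      simp [Finset.card_def, eq_comm]
    rw [← h1, List.ofFn_succ, List.count_cons_of_ne (by omega)]
  have := card_degree_three_of_isContained hG (x := 0) (by rw [h0, Fintype.card_fin]) (by omega)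
    (fun v hv => by
      obtain ⟨i, rfl⟩ := Fin.exists_succ_eq.2 hv
      exact hL3 _ (List.mem_ofFn.2 ⟨i, rfl⟩)) hH
  rw [hcount] at this
  refine ⟨this.1, fun h2 => this.2 fun v hv => ?_⟩
  rcases Fin.eq_zero_or_eq_succ v with rfl | ⟨i, rfl⟩
  · omega
  · exact h2 (List.mem_ofFn.2 ⟨i, hv⟩)

/-- The edge-counting obstruction to containing `K₅ - A₃`. -/
def Obstructed (s : Multiset ℕ) : Prop :=
  ∀ A ∈ s.powersetCard 5, (∀ y ∈ A, 2 ≤ y) → 4 ≤ A.countP (3 ≤ ·) →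
    ¬ ((s - A).map fun y => y - (Multiset.card (s - A) - 1)).sum + 14 ≤ A.sum

instance (s : Multiset ℕ) : Decidable (Obstructed s) := by
  unfold Obstructed
  infer_instance

/-- The edge count depends on the copy only through the degrees of its five vertices, so it can be
tested on five-element submultisets. -/
theorem IsPotentiallyGraphic.ofFn_ne {n : ℕ} {π : Fin n → ℕ}
    (h : IsPotentiallyGraphic graphK5SubA3 π) {L : List ℕ} (hL : Obstructed L) :
    List.ofFn π ≠ L := by
  intro heq
  obtain ⟨-, G, hG, hH⟩ := h
  obtain ⟨S, hS, h2, h3, h4⟩ := exists_five_of_isContained hG hH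
  have hsum : S.val.map π + Sᶜ.val.map π = L := by
    rw [← map_univ_eq_of_ofFn_eq heq, ← Multiset.map_add]
    congr 1
    rw [← Finset.disjUnion_val S Sᶜ disjoint_compl_right, Finset.disjUnion_eq_union,
      Finset.union_compl]
  have hsub : (L : Multiset ℕ) - S.val.map π = Sᶜ.val.map π := by
    rw [← hsum, add_tsub_cancel_left]
  refine hL (S.val.map π) (Multiset.mem_powersetCard.2 ⟨hsum ▸ Multiset.le_add_right _ _, ?_⟩)
    ?_ ?_ ?_
  · rw [Multiset.card_map]
    exact (Finset.mem_powersetCard.1 hS).2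
  · intro y hy
    obtain ⟨v, hv, rfl⟩ := Multiset.mem_map.1 hy
    exact h2 v hv
  · rw [Multiset.countP_map]
    exact h3
  · rw [hsub, Multiset.map_map, Multiset.card_map]
    exact h4

/-! ### The characterization -/

theorem theorem3p2 (n : ℕ) (hn : 5 ≤ n) (π : Fin n → ℕ) (hπ : IsGraphic π)
    (hpos : ∀ i, 0 < π i) :
    IsPotentiallyGraphic graphK5SubA3 π ↔
      (3 ≤ π ⟨3, by omega⟩ ∧ 2 ≤ π ⟨4, by omega⟩) ∧
      (∀ k : ℕ, 6 ≤ n → 4 ≤ k → k ≤ n - 2 → n ≡ k [MOD 2] →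
        List.ofFn π ≠ [n - 1] ++ rep 3 3 ++ rep 2 (n - k) ++ rep 1 (k - 4)) ∧
      (List.ofFn π ≠ rep 3 4 ++ rep 2 2 ∧
        List.ofFn π ≠ rep 3 6 ∧
        List.ofFn π ≠ rep 3 4 ++ rep 2 3 ∧
        List.ofFn π ≠ rep 3 6 ++ [2] ∧
        List.ofFn π ≠ [4] ++ rep 3 6 ∧
        List.ofFn π ≠ rep 3 7 ++ [1] ∧
        List.ofFn π ≠ rep 3 8 ∧
        (6 ≤ n → List.ofFn π ≠ [n - 1] ++ rep 3 5 ++ rep 1 (n - 6)) ∧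
        (7 ≤ n → List.ofFn π ≠ [n - 1] ++ rep 3 6 ++ rep 1 (n - 7))) := by
  constructor
  · intro h
    refine ⟨?_, ?_, h.ofFn_ne (by decide +kernel), h.ofFn_ne (by decide +kernel),
      h.ofFn_ne (by decide +kernel), h.ofFn_ne (by decide +kernel), h.ofFn_ne (by decide +kernel),
      h.ofFn_ne (by decide +kernel), h.ofFn_ne (by decide +kernel), ?_, ?_⟩
    · obtain ⟨hanti, G, hG, hH⟩ := h
      obtain ⟨S, hS, h2, h3, -⟩ := exists_five_of_isContained hG hH
      have hc := (Finset.mem_powersetCard.1 hS).2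
      exact ⟨le_of_le_card_filter hanti _ (fun j hj => (Finset.mem_filter.1 hj).2) h3,
        le_of_le_card_filter hanti _ h2 (by rw [hc]; exact Nat.lt_succ_self 4)⟩
    · intro k hn6 hk hk' hmod heq
      -- Three threes are fewer than the four required; in the next two families five and six threes
      -- fall in the forbidden gap.
      have := (h.count_three hn (L := rep 3 3 ++ rep 2 (n - k) ++ rep 1 (k - 4)) (by simpa using heq)
        (by simp only [List.mem_append, List.mem_replicate]; omega)).1
      simp [List.count_replicate] at this
    · intro hn6 heq
      have := (h.count_three hn (L := rep 3 5 ++ rep 1 (n - 6)) (by simpa using heq)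
        (by simp only [List.mem_append, List.mem_replicate]; omega)).2
        (by simp only [List.mem_append, List.mem_replicate]; omega)
      simp [List.count_replicate] at this
    · intro hn6 heq
      have := (h.count_three hn (L := rep 3 6 ++ rep 1 (n - 7)) (by simpa using heq)
        (by simp only [List.mem_append, List.mem_replicate]; omega)).2
        (by simp only [List.mem_append, List.mem_replicate]; omega)
      simp [List.count_replicate] at this
  · rintro ⟨⟨h3, h2⟩, hk, e1, e2, e3, e4, e5, e6, e7, e8, e9⟩
    refine isPotentiallyGraphic_of_not_exceptional hπ hpos rfl rfl h3 h2 fun x a b c hL hE => ?_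
    have hlen := congrArg List.length hL
    simp only [List.length_ofFn, List.length_cons, List.length_append, List.length_replicate]
      at hlen
    rcases hE with h | h | h | h | h | h | h | h | h | h
    · obtain ⟨hx, rfl, hb, hb2⟩ := h
      -- The head and the three threes give `n = b + c + 4`, so `c = k - 4` forces this `k`; the
      -- congruence says that `b` is even.
      refine hk (c + 4) (by omega) (by omega) (by omega) ?_ ?_
      · unfold Nat.ModEq; omega
      · rw [hL, show x = n - 1 by omega, show n - (c + 4) = b by omega,
          show c + 4 - 4 = c by omega]
        simp
    · obtain ⟨hx, rfl, rfl⟩ := h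
      refine e8 (by omega) ?_
      rw [hL, show x = n - 1 by omega, show n - 6 = c by omega]
      rfl
    · obtain ⟨hx, rfl, rfl⟩ := h
      refine e9 (by omega) ?_
      rw [hL, show x = n - 1 by omega, show n - 7 = c by omega]
      rfl
    all_goals obtain ⟨rfl, rfl, rfl, rfl⟩ := h
    · exact e1 hL
    · exact e2 hL
    · exact e3 hL
    · exact e4 hL
    · exact e5 hL
    · exact e6 hL
    · exact e7 hL
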